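/- Let $\Sigma\in\mathbb R^{d\times d}$ be positive definite, $\sigma>0$, and $\theta\in\mathbb R^d$. There are $m$ agents. For agent $i$ a permutation matrix $\Pi_i=\begin{bmatrix}\Pi_{i+}\\ \Pi_{i-}\end{bmatrix}$ splits the $d$ features into $d_i$ observed and $d-d_i$ missing ones; for $v\in\mathbb R^d$ write $v_{i\pm}=\Pi_{i\pm}v$, and $\Sigma_{i+}=\Pi_{i+}\Sigma\Pi_{i+}^\top$, $\Sigma_{i-}=\Pi_{i-}\Sigma\Pi_{i-}^\top$, $\Sigma_{i\pm}=\Pi_{i+}\Sigma\Pi_{i-}^\top$, $\Sigma_{i\mp}=\Sigma_{i\pm}^\top$. Put $$T_i=\begin{bmatrix}I_{d_i}&\Sigma_{i+}^{-1}\Sigma_{i\pm}\end{bmatrix}\Pi_i,\quad \Gamma_{i-}=\Sigma_{i-}-\Sigma_{i\mp}\Sigma_{i+}^{-1}\Sigma_{i\pm},\quad W_i^{g}=\frac{\Sigma_{i+}}{\theta_{i-}^\top\Gamma_{i-}\theta_{i-}+\sigma^2},\quad C^{g}=\Big(\sum_{i=1}^mT_i^\top W_i^{g}T_i\Big)^{-1},$$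 where $\sum_iT_i^\top W_i^{g}T_i$ is assumed to be invertible. *Observation model.* For fixed matrices $X_{i+}\in\mathbb R^{n\times d_i}$ and a parameter $\vartheta\in\mathbb R^d$, draw for each agent $i$ and each row $x_{i+}$ of $X_{i+}$, all independently, the missing features $x_{i-}\sim\mathsf N(\Sigma_{i\mp}\Sigma_{i+}^{-1}x_{i+},\Gamma_{i-})$ and the noise $\xi\sim\mathsf N(0,\sigma^2)$, and let the corresponding entry of $y_i\in\mathbb R^n$ be $\langle x_{i+},\vartheta_{i+}\rangle+\langle x_{i-},\vartheta_{i-}\rangle+\xi$. Let $P_\vartheta$ be the joint law of the local least squares estimates $\hat\theta_i=(X_{i+}^\top X_{i+})^{-1}X_{i+}^\top y_i$, $i=1,\dots,m$. For $\psi:\mathbb R^d\to\mathbb R^s$ and $u\in\mathbb R^s$ let $$\mathfrak M_{n,c}(\psi,u)=\inf_{\bar\theta}\ \sup_{\|\vartheta-\theta\|_2\le cn^{-1/2}} n\,\mathbb E_{Z\sim P_\vartheta}\big\langle u,\bar\theta(Z)-\psi(\vartheta)\big\rangle^2,$$ the infimum being over all measurable functions $\bar\theta$ of $Z=(\hat\theta_1,\dots,\hat\theta_m)$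 (which may depend on the $X_{i+}$, on $\Sigma$ and on $n$). *Lower bounds.* For all $i$ and $n$ let the $n$ rows of $X_{i+}=X_{i+}^{(n)}$ be drawn i.i.d. from $\mathsf N(0,\Sigma_{i+})$ and then held fixed. Then for every $u\in\mathbb R^d$, with probability $1$, $$\liminf_{c\to\infty}\liminf_{n\to\infty}\mathfrak M_{n,c}(\mathrm{id},u)\ \ge\ u^\top C^{g}u,$$ and for every $i$ and every $u\in\mathbb R^{d_i}$, with probability $1$, $$\liminf_{c\to\infty}\liminf_{n\to\infty}\mathfrak M_{n,c}(T_i,u)\ \ge\ u^\top T_iC^{g}T_i^\top u .$$ *Match with the Collab upper bound.* For each $n$ let each agent $i$ have $n$ samples $y=\langle x,\theta\rangle+\xi$ with $x\sim\mathsf N(0,\Sigma)$ and $\xi\sim\mathsf N(0,\sigma^2)$, all independent, of which it sees $(x_{i+},y)$. Let $\hat\theta_i$ be its least squares estimate, $R_i=\frac1n\|X_{i+}\hat\theta_i-y_i\|_2^2$, $\hat W_i=\Sigma_{i+}/R_i$, and let $\hat\theta^{\mathrm{clb}}$ be a (measurable) minimizer of $\vartheta\mapsto\sum_i(T_i\vartheta-\hat\theta_i)^\top\hat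 W_i(T_i\vartheta-\hat\theta_i)$. Then, in distribution as $n\to\infty$, $\sqrt n(\hat\theta^{\mathrm{clb}}-\theta)\to\mathsf N(0,C^{g})$, and $\sqrt n(T_i\hat\theta^{\mathrm{clb}}-T_i\theta)\to\mathsf N(0,T_iC^{g}T_i^\top)$ for every $i$. -/

import Mathlib

open MeasureTheory ProbabilityTheory Filter Matrix
open scoped ENNReal

/-- The views of `m` agents on `d` features. Agent `i` observes `obs i` features and misses `hid i`
features; the permutation `view i` lists the observed features first and the missing ones second
(it is the permutation matrix `Π_i`, with blocks `Π_{i+}` and `Π_{i-}`). -/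
structure Views (m d : ℕ) where
  obs : Fin m → ℕ
  hid : Fin m → ℕ
  view : (i : Fin m) → Fin (obs i) ⊕ Fin (hid i) ≃ Fin d

/-- The ordinary least squares estimate `(XᵀX)⁻¹Xᵀy`. -/
noncomputable def olsEstimate {n p : ℕ} (X : Matrix (Fin n) (Fin p) ℝ) (y : Fin n → ℝ) :
    EuclideanSpace ℝ (Fin p) :=
  WithLp.toLp 2 ((Xᵀ * X)⁻¹ *ᵥ (Xᵀ *ᵥ y))

/-- The linear map `v ↦ A v` between Euclidean spaces. -/
noncomputable def euclMul {p q : ℕ} (A : Matrix (Fin p) (Fin q) ℝ)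
    (v : EuclideanSpace ℝ (Fin q)) : EuclideanSpace ℝ (Fin p) :=
  WithLp.toLp 2 (A *ᵥ v.ofLp)

namespace Views

variable {m d : ℕ} (V : Views m d)

/-- `v_{i+}`, the observed coordinates of `v`. -/
noncomputable def plus (i : Fin m) (v : EuclideanSpace ℝ (Fin d)) :
    EuclideanSpace ℝ (Fin (V.obs i)) :=
  WithLp.toLp 2 fun a => v (V.view i (Sum.inl a))

/-- `v_{i-}`, the missing coordinates of `v`. -/
noncomputable def minus (i : Fin m) (v : EuclideanSpace ℝ (Fin d)) :
    EuclideanSpace ℝ (Fin (V.hid i)) :=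
  WithLp.toLp 2 fun a => v (V.view i (Sum.inr a))

/-- The observed-observed block `A_{i+}`. -/
def blockPP (i : Fin m) (A : Matrix (Fin d) (Fin d) ℝ) :
    Matrix (Fin (V.obs i)) (Fin (V.obs i)) ℝ :=
  A.submatrix (fun a => V.view i (Sum.inl a)) (fun a => V.view i (Sum.inl a))

/-- The observed-missing block `A_{i±}`. -/
def blockPM (i : Fin m) (A : Matrix (Fin d) (Fin d) ℝ) :
    Matrix (Fin (V.obs i)) (Fin (V.hid i)) ℝ :=
  A.submatrix (fun a => V.view i (Sum.inl a)) (fun a => V.view i (Sum.inr a))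

/-- The missing-observed block `A_{i∓}`. -/
def blockMP (i : Fin m) (A : Matrix (Fin d) (Fin d) ℝ) :
    Matrix (Fin (V.hid i)) (Fin (V.obs i)) ℝ :=
  A.submatrix (fun a => V.view i (Sum.inr a)) (fun a => V.view i (Sum.inl a))

/-- The missing-missing block `A_{i-}`. -/
def blockMM (i : Fin m) (A : Matrix (Fin d) (Fin d) ℝ) :
    Matrix (Fin (V.hid i)) (Fin (V.hid i)) ℝ :=
  A.submatrix (fun a => V.view i (Sum.inr a)) (fun a => V.view i (Sum.inr a))

/-- `T_i = [I, Σ_{i+}⁻¹ Σ_{i±}] Π_i`. -/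
noncomputable def transfer (S : Matrix (Fin d) (Fin d) ℝ) (i : Fin m) :
    Matrix (Fin (V.obs i)) (Fin d) ℝ :=
  (Matrix.fromCols 1 ((V.blockPP i S)⁻¹ * V.blockPM i S)).submatrix id (V.view i).symm

/-- The Schur complement `Γ_{i-} = Σ_{i-} - Σ_{i∓} Σ_{i+}⁻¹ Σ_{i±}`. -/
noncomputable def schur (S : Matrix (Fin d) (Fin d) ℝ) (i : Fin m) :
    Matrix (Fin (V.hid i)) (Fin (V.hid i)) ℝ :=
  V.blockMM i S - V.blockMP i S * (V.blockPP i S)⁻¹ * V.blockPM i S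

/-- The Gaussian weights `W_i^g = Σ_{i+} / (θ_{i-}ᵀ Γ_{i-} θ_{i-} + σ²)`. -/
noncomputable def gaussWeight (S : Matrix (Fin d) (Fin d) ℝ) (σ : ℝ)
    (θ : EuclideanSpace ℝ (Fin d)) (i : Fin m) : Matrix (Fin (V.obs i)) (Fin (V.obs i)) ℝ :=
  ((V.minus i θ).ofLp ⬝ᵥ V.schur S i *ᵥ (V.minus i θ).ofLp + σ ^ 2)⁻¹ • V.blockPP i S

/-- `∑ i, T_iᵀ W_i^g T_i`. -/
noncomputable def precision (S : Matrix (Fin d) (Fin d) ℝ) (σ : ℝ)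
    (θ : EuclideanSpace ℝ (Fin d)) : Matrix (Fin d) (Fin d) ℝ :=
  ∑ i, (V.transfer S i)ᵀ * V.gaussWeight S σ θ i * V.transfer S i

/-- `C^g = (∑ i, T_iᵀ W_i^g T_i)⁻¹`. -/
noncomputable def covG (S : Matrix (Fin d) (Fin d) ℝ) (σ : ℝ)
    (θ : EuclideanSpace ℝ (Fin d)) : Matrix (Fin d) (Fin d) ℝ :=
  (V.precision S σ θ)⁻¹

/-! ### The weak observation model (partially fixed design) -/

/-- Given the observed part `x` of a sample of agent `i`, the joint law of its missing part, which
is `N(Σ_{i∓} Σ_{i+}⁻¹ x, Γ_{i-})`, and of its independent label noise, which is `N(0, σ²)`. -/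
noncomputable def hiddenRowLaw (S : Matrix (Fin d) (Fin d) ℝ) (σ : ℝ) (i : Fin m)
    (x : EuclideanSpace ℝ (Fin (V.obs i))) :
    Measure (EuclideanSpace ℝ (Fin (V.hid i)) × ℝ) :=
  (multivariateGaussian (euclMul (V.blockMP i S * (V.blockPP i S)⁻¹) x) (V.schur S i)).prod
    (gaussianReal 0 (σ ^ 2).toNNReal)

/-- The label vector of agent `i`, with entries `⟨x_{i+}, ϑ_{i+}⟩ + ⟨x_{i-}, ϑ_{i-}⟩ + ξ`. -/
noncomputable def fixedLabels {n : ℕ} (ϑ : EuclideanSpace ℝ (Fin d)) (i : Fin m)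
    (X : Fin n → EuclideanSpace ℝ (Fin (V.obs i)))
    (h : Fin n → EuclideanSpace ℝ (Fin (V.hid i)) × ℝ) : Fin n → ℝ :=
  fun k => inner ℝ (X k) (V.plus i ϑ) + inner ℝ (h k).1 (V.minus i ϑ) + (h k).2

/-- The joint law of the local least squares estimates `(θ̂_1, …, θ̂_m)` under the parameter `ϑ`,
when the observed features are held fixed at the rows `X i k`: all missing parts and all noises
are independent over agents and samples. -/
noncomputable def olsLaw {n : ℕ} (S : Matrix (Fin d) (Fin d) ℝ) (σ : ℝ)
    (X : (i : Fin m) → Fin n → EuclideanSpace ℝ (Fin (V.obs i)))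
    (ϑ : EuclideanSpace ℝ (Fin d)) :
    Measure ((i : Fin m) → EuclideanSpace ℝ (Fin (V.obs i))) :=
  (Measure.pi fun i => Measure.pi fun k => V.hiddenRowLaw S σ i (X i k)).map
    fun h i => olsEstimate (Matrix.of fun k => (X i k).ofLp) (V.fixedLabels ϑ i (X i) (h i))

/-- The local minimax risk for the estimation of `⟨u, ψ ϑ⟩` from the local least squares
estimates, over `‖ϑ - θ‖ ≤ c / √n`, for the fixed observed features `X`. The infimum is over all
measurable functions of `(θ̂_1, …, θ̂_m)`; as it is taken with everything else fixed, these may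
depend on `X`, on `Σ` and on `n` in an arbitrary way. -/
noncomputable def minimaxRisk {n s : ℕ} (S : Matrix (Fin d) (Fin d) ℝ) (σ : ℝ)
    (θ : EuclideanSpace ℝ (Fin d))
    (X : (i : Fin m) → Fin n → EuclideanSpace ℝ (Fin (V.obs i)))
    (ψ : EuclideanSpace ℝ (Fin d) → EuclideanSpace ℝ (Fin s)) (c : ℝ)
    (u : EuclideanSpace ℝ (Fin s)) : ℝ≥0∞ :=
  ⨅ (est : ((i : Fin m) → EuclideanSpace ℝ (Fin (V.obs i))) → EuclideanSpace ℝ (Fin s))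
    (_ : Measurable est),
    ⨆ (ϑ : EuclideanSpace ℝ (Fin d)) (_ : ‖ϑ - θ‖ ≤ c / √(n : ℝ)),
      ∫⁻ z, ENNReal.ofReal (n * inner ℝ u (est z - ψ ϑ) ^ 2) ∂(V.olsLaw S σ X ϑ)

/-- For all `n` and `i`, the `n` rows `X n i k` of the observed design of agent `i` are i.i.d.
`N(0, Σ_{i+})`. Nothing is asked of the joint law over different `n` (the designs may be nested or
not) or over different agents. -/
structure IsGaussianDesign {Ω : Type*} [MeasurableSpace Ω] (S : Matrix (Fin d) (Fin d) ℝ)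
    (X : (n : ℕ) → (i : Fin m) → Fin n → Ω → EuclideanSpace ℝ (Fin (V.obs i)))
    (P : Measure Ω) : Prop where
  law : ∀ n i k, HasLaw (X n i k) (multivariateGaussian 0 (V.blockPP i S)) P
  indep : ∀ n i, iIndepFun (X n i) P

/-! ### The Collab estimator (random design) -/

/-- The local least squares estimate `θ̂_i` from full feature vectors `x i k` and labels `y i k`. -/
noncomputable def localOLS {n : ℕ} (x : Fin m → Fin n → EuclideanSpace ℝ (Fin d))
    (y : Fin m → Fin n → ℝ) (i : Fin m) : EuclideanSpace ℝ (Fin (V.obs i)) :=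
  olsEstimate (Matrix.of fun k => (V.plus i (x i k)).ofLp) (y i)

/-- The mean squared residual `R_i = ‖X_{i+} θ̂_i - y_i‖² / n`. -/
noncomputable def residual {n : ℕ} (x : Fin m → Fin n → EuclideanSpace ℝ (Fin d))
    (y : Fin m → Fin n → ℝ) (i : Fin m) : ℝ :=
  (n : ℝ)⁻¹ * ∑ k, (inner ℝ (V.plus i (x i k)) (V.localOLS x y i) - y i k) ^ 2

/-- The weighted empirical risk `∑ i, ‖T_i ϑ - z_i‖²_{W_i}` at `ϑ`. -/
noncomputable def weightedRisk (S : Matrix (Fin d) (Fin d) ℝ)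
    (W : (i : Fin m) → Matrix (Fin (V.obs i)) (Fin (V.obs i)) ℝ)
    (z : (i : Fin m) → EuclideanSpace ℝ (Fin (V.obs i))) (ϑ : EuclideanSpace ℝ (Fin d)) : ℝ :=
  ∑ i, (euclMul (V.transfer S i) ϑ - z i).ofLp ⬝ᵥ
    W i *ᵥ (euclMul (V.transfer S i) ϑ - z i).ofLp

/-- `ϑ` is a Collab estimate for the data `(x, y)`: it minimizes the weighted empirical risk of the
local least squares estimates, with the weights `Ŵ_i = Σ_{i+} / R_i`. -/
def IsCollab {n : ℕ} (S : Matrix (Fin d) (Fin d) ℝ)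
    (x : Fin m → Fin n → EuclideanSpace ℝ (Fin d)) (y : Fin m → Fin n → ℝ)
    (ϑ : EuclideanSpace ℝ (Fin d)) : Prop :=
  IsMinOn (V.weightedRisk S (fun i => (V.residual x y i)⁻¹ • V.blockPP i S) (V.localOLS x y))
    Set.univ ϑ

end Views

/-- For each `n`, the pairs `(x n i k, ξ n i k)` over agents `i` and samples `k < n` are
independent, with features `N(0, Σ)` and independent noise `N(0, σ²)`. -/
structure IsGaussianData {m d : ℕ} {Ω : Type*} [MeasurableSpace Ω]
    (S : Matrix (Fin d) (Fin d) ℝ) (σ : ℝ)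
    (x : (n : ℕ) → Fin m → Fin n → Ω → EuclideanSpace ℝ (Fin d))
    (ξ : (n : ℕ) → Fin m → Fin n → Ω → ℝ) (P : Measure Ω) : Prop where
  law : ∀ n i k, HasLaw (fun ω => (x n i k ω, ξ n i k ω))
    ((multivariateGaussian 0 S).prod (gaussianReal 0 (σ ^ 2).toNNReal)) P
  indep : ∀ n, iIndepFun (fun (p : Fin m × Fin n) ω => (x n p.1 p.2 ω, ξ n p.1 p.2 ω)) P

/-! Lower bound. Given the observed features, a label of agent `i` is Gaussian with mean `⟨x_{i+},
T_i ϑ⟩` and variance `v_i(ϑ) = ϑ_{i-}ᵀ Γ_{i-} ϑ_{i-} + σ²`. Hence the local least squares estimates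
are independent with laws `N(T_i ϑ, v_i(ϑ) (X_{i+}ᵀ X_{i+})⁻¹)`: a Gaussian shift family, except
that its covariance moves with `ϑ`. On a ball of radius `c/√n` the variances hardly move, and a
Gaussian law dominates, up to a constant close to 1, one with a slightly smaller covariance
(`gaussianReal_le_of_var_le`, `le_olsLaw`). The constant depends on the number of observed
coordinates but not on `n`, so it survives the limit. In a true shift family, restricted to the line
`θ + (t/√n) w`, a Gaussian prior on `t` gives an exact Bayes bound: the error of the posterior mean
is independent of the observation, so no estimator can reduce it (`gaussianShift_bayesRisk_ge`).
Clipping the estimator makes the bound local (`gaussianShift_minimax_ge`). The hardest direction is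
`w = C^g u`, along which the information converges to `uᵀ C^g u` by the law of large numbers for the
Gram matrices; flattening the prior yields the variance bound `uᵀ C^g u`. The bound for `T_i` is the
same bound at `T_iᵀ u`. Upper bound. Write `y = ⟨x_{i+}, T_i θ⟩ + e_i`, where the effective noise
`e_i` is uncorrelated with `x_{i+}`, hence independent of it by joint Gaussianity, and has variance
`v_i(θ)`. The normal equations make the Collab error linear in the scores, the means of `e_i
x_{i+}`, with coefficients that converge almost surely because `R_i → v_i(θ)`. The limiting linear
form has covariance `C^g (C^g)⁻¹ C^g = C^g`, by the central limit theorem for the scores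
(`tendstoInDistribution_totalScore`). The remainder is small relative to fourth powers of the
normalized scores, whose means stay bounded, so Slutsky's lemma applies. Nothing is assumed about
the joint law of the data for different `n`, so all limit theorems are for triangular arrays. -/

/-! ### Strong law of large numbers for triangular arrays. -/

section TriangularArrays

variable {Ω : Type*} [MeasurableSpace Ω] {P : Measure Ω}

lemma integrable_pow_of_memLp_four [IsFiniteMeasure P] {f : Ω → ℝ} (hf : MemLp f 4 P) {k : ℕ}
    (hk : k ≤ 4) : Integrable (fun ω => f ω ^ k) P := by
  have hk' : MemLp f (k : ℝ≥0∞) P := hf.mono_exponent (by exact_mod_cast hk)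
  have := hk'.integrable_norm_pow'
  refine this.mono' (hf.aestronglyMeasurable.pow k) (Eventually.of_forall fun ω => ?_)
  simp

/-- Second and fourth moments of a sum of independent centred random variables. -/
lemma integral_sum_sq_and_pow_four_le [IsProbabilityMeasure P] {ι : Type*} {Y : ι → Ω → ℝ}
    (hind : iIndepFun Y P) (hL : ∀ i, MemLp (Y i) 4 P) (h0 : ∀ i, ∫ ω, Y i ω ∂P = 0) {B K : ℝ}
    (hB : ∀ i, ∫ ω, Y i ω ^ 2 ∂P ≤ B) (hK : ∀ i, ∫ ω, Y i ω ^ 4 ∂P ≤ K) (s : Finset ι) :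
    ∫ ω, (∑ i ∈ s, Y i ω) ^ 2 ∂P ≤ s.card * B ∧
      ∫ ω, (∑ i ∈ s, Y i ω) ^ 4 ∂P ≤ 3 * s.card ^ 2 * B ^ 2 + s.card * K := by
  classical
  induction s using Finset.induction with
  | empty => simp
  | insert a s ha ih =>
    obtain ⟨ih2, ih4⟩ := ih
    set S : Ω → ℝ := fun ω => ∑ i ∈ s, Y i ω with hS
    have hSL : MemLp S 4 P := memLp_finsetSum s fun i _ => hL i
    have hSY : IndepFun S (Y a) P := by
      have := hind.indepFun_finsetSum_of_notMem₀ (fun i => (hL i).aestronglyMeasurable.aemeasurable) ha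
      convert this using 1
      ext ω; simp [hS]
    have hmul : ∀ p q : ℕ, ∫ ω, S ω ^ p * Y a ω ^ q ∂P
        = (∫ ω, S ω ^ p ∂P) * ∫ ω, Y a ω ^ q ∂P := fun p q =>
      hSY.integral_fun_comp_mul_comp (f := fun x => x ^ p) (g := fun x => x ^ q)
        hSL.aestronglyMeasurable.aemeasurable (hL a).aestronglyMeasurable.aemeasurable
        (by fun_prop) (by fun_prop)
    have hfint : ∀ p q : ℕ, p ≤ 4 → q ≤ 4 → Integrable (fun ω => S ω ^ p * Y a ω ^ q) P :=
      fun p q hp hq => (hSY.comp (φ := fun x => x ^ p) (ψ := fun x => x ^ q)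
        (by fun_prop) (by fun_prop)).integrable_mul (integrable_pow_of_memLp_four hSL hp)
          (integrable_pow_of_memLp_four (hL a) hq)
    have hS0 : ∫ ω, S ω ∂P = 0 := by
      rw [hS, integral_finsetSum]
      · simp [h0]
      · exact fun i _ => (hL i).integrable (by norm_num)
    have hB0 : 0 ≤ B := (integral_nonneg fun ω => sq_nonneg (Y a ω)).trans (hB a)
    have hSs0 : 0 ≤ ∫ ω, S ω ^ 2 ∂P := integral_nonneg fun ω => sq_nonneg _
    have hY2 : 0 ≤ ∫ ω, Y a ω ^ 2 ∂P := integral_nonneg fun ω => sq_nonneg _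
    have e1 := h0 a
    have m11 := hmul 1 1
    have m31 := hmul 3 1
    have m13 := hmul 1 3
    have m22 := hmul 2 2
    -- By independence and centring, every mixed moment with a factor of degree one vanishes. Of the
    -- mixed terms only the (2,2) one survives.
    simp only [pow_one, hS0, e1, mul_zero, zero_mul] at m11 m31 m13
    have hc : ((insert a s).card : ℝ) = s.card + 1 := by
      rw [Finset.card_insert_of_notMem ha]; push_cast; ring
    have i11 : Integrable (fun ω => S ω * Y a ω) P := by simpa using hfint 1 1 (by lia) (by lia)
    have i31 : Integrable (fun ω => S ω ^ 3 * Y a ω) P := by simpa using hfint 3 1 (by lia) (by lia)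
    have i13 : Integrable (fun ω => S ω * Y a ω ^ 3) P := by simpa using hfint 1 3 (by lia) (by lia)
    have i22 := hfint 2 2 (by lia) (by lia)
    have iS := fun k hk => integrable_pow_of_memLp_four (k := k) hSL hk
    have iY := fun k hk => integrable_pow_of_memLp_four (k := k) (hL a) hk
    constructor
    · have : ∫ ω, (∑ i ∈ insert a s, Y i ω) ^ 2 ∂P
          = ∫ ω, (S ω ^ 2 + 2 * (S ω * Y a ω)) + Y a ω ^ 2 ∂P := by
        congr 1; ext ω; rw [Finset.sum_insert ha]; simp only [hS]; ring
      have j : Integrable (fun ω => S ω ^ 2 + 2 * (S ω * Y a ω)) P :=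
        (iS 2 (by lia)).add (i11.const_mul _)
      rw [this, integral_add j (iY 2 (by lia)),
        integral_add (iS 2 (by lia)) (i11.const_mul _), integral_const_mul, m11, hc]
      linarith [hB a]
    · have : ∫ ω, (∑ i ∈ insert a s, Y i ω) ^ 4 ∂P
          = ∫ ω, (((S ω ^ 4 + 4 * (S ω ^ 3 * Y a ω)) + 6 * (S ω ^ 2 * Y a ω ^ 2))
            + 4 * (S ω * Y a ω ^ 3)) + Y a ω ^ 4 ∂P := by
        congr 1; ext ω; rw [Finset.sum_insert ha]; simp only [hS]; ring
      have j1 : Integrable (fun ω => S ω ^ 4 + 4 * (S ω ^ 3 * Y a ω)) P :=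
        (iS 4 le_rfl).add (i31.const_mul 4)
      have j2 : Integrable (fun ω => S ω ^ 4 + 4 * (S ω ^ 3 * Y a ω)
          + 6 * (S ω ^ 2 * Y a ω ^ 2)) P := j1.add (i22.const_mul 6)
      have j3 : Integrable (fun ω => S ω ^ 4 + 4 * (S ω ^ 3 * Y a ω)
          + 6 * (S ω ^ 2 * Y a ω ^ 2) + 4 * (S ω * Y a ω ^ 3)) P := j2.add (i13.const_mul 4)
      rw [this, integral_add j3 (iY 4 le_rfl), integral_add j2 (i13.const_mul 4),
        integral_add j1 (i22.const_mul 6), integral_add (iS 4 le_rfl) (i31.const_mul 4),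
        integral_const_mul, integral_const_mul, integral_const_mul, m31, m13, m22, hc]
      have : (∫ ω, S ω ^ 2 ∂P) * ∫ ω, Y a ω ^ 2 ∂P ≤ (s.card * B) * B :=
        mul_le_mul ih2 (hB a) hY2 (by positivity)
      -- `3 * card ^ 2 * B ^ 2` grows by `(6 * card + 3) * B ^ 2`, which absorbs the (2,2) term with
      -- its binomial coefficient 6.
      nlinarith [hK a, sq_nonneg B]

variable {𝓧 : Type*} [MeasurableSpace 𝓧] {ν : Measure 𝓧}

/-- Fourth moments of row sums of a triangular array with i.i.d. rows. -/
lemma exists_integral_rowSum_pow_four_le [IsProbabilityMeasure P]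
    {Z : (n : ℕ) → Fin n → Ω → 𝓧} (hlaw : ∀ n k, HasLaw (Z n k) ν P)
    (hind : ∀ n, iIndepFun (Z n) P) {f : 𝓧 → ℝ} (hfm : Measurable f) (hf : MemLp f 4 ν)
    (hf0 : ∫ x, f x ∂ν = 0) :
    ∃ K : ℝ, 0 ≤ K ∧ ∀ n, Integrable (fun ω => (∑ k, f (Z n k ω)) ^ 4) P ∧
      ∫ ω, (∑ k, f (Z n k ω)) ^ 4 ∂P ≤ K * n ^ 2 := by
  refine ⟨3 * (∫ x, f x ^ 2 ∂ν) ^ 2 + ∫ x, f x ^ 4 ∂ν,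
    add_nonneg (by positivity) (integral_nonneg fun x => by positivity), fun n => ?_⟩
  have hfint : ∀ (j : ℕ) k, ∫ ω, f (Z n k ω) ^ j ∂P = ∫ x, f x ^ j ∂ν := fun j k =>
    (hlaw n k).integral_comp (f := fun x => f x ^ j) (hfm.pow_const j).aestronglyMeasurable
  have hL : ∀ k, MemLp (fun ω => f (Z n k ω)) 4 P := fun k => by
    rw [← (hlaw n k).map_eq] at hf
    exact (memLp_map_measure_iff hfm.aestronglyMeasurable (hlaw n k).aemeasurable).1 hf
  have hsum : MemLp (fun ω => ∑ k, f (Z n k ω)) 4 P := memLp_finsetSum _ fun k _ => hL k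
  refine ⟨integrable_pow_of_memLp_four hsum le_rfl, ?_⟩
  have := (integral_sum_sq_and_pow_four_le (Y := fun k ω => f (Z n k ω))
    ((hind n).comp (fun _ => f) fun _ => hfm) hL
    (fun k => by simpa using (hfint 1 k).trans (by simpa using hf0))
    (B := ∫ x, f x ^ 2 ∂ν) (K := ∫ x, f x ^ 4 ∂ν)
    (fun k => (hfint 2 k).le) (fun k => (hfint 4 k).le) Finset.univ).2
  refine this.trans ?_
  have h4 : 0 ≤ ∫ x, f x ^ 4 ∂ν := integral_nonneg fun x => by positivity
  have hn : (n : ℝ) ≤ n ^ 2 := by exact_mod_cast Nat.le_self_pow two_ne_zero n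
  simp only [Finset.card_univ, Fintype.card_fin]
  nlinarith [mul_le_mul_of_nonneg_right hn h4]

/-- Strong law of large numbers for triangular arrays with i.i.d. rows and four moments; nothing is
asked of the joint law of different rows. -/
lemma ae_tendsto_rowMean [IsProbabilityMeasure P]
    {Z : (n : ℕ) → Fin n → Ω → 𝓧} (hlaw : ∀ n k, HasLaw (Z n k) ν P)
    (hind : ∀ n, iIndepFun (Z n) P) {f : 𝓧 → ℝ} (hfm : Measurable f) (hf : MemLp f 4 ν) :
    ∀ᵐ ω ∂P, Tendsto (fun n : ℕ => (n : ℝ)⁻¹ * ∑ k, f (Z n k ω)) atTop (nhds (∫ x, f x ∂ν)) := by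
  have hν : IsProbabilityMeasure ν := by
    rw [← (hlaw 1 0).map_eq]; exact Measure.isProbabilityMeasure_map (hlaw 1 0).aemeasurable
  set μ := ∫ x, f x ∂ν with hμ
  set g : 𝓧 → ℝ := fun x => f x - μ with hg
  have hgL : MemLp g 4 ν := hf.sub (memLp_const μ)
  have hg0 : ∫ x, g x ∂ν = 0 := by
    rw [hg, integral_sub (hf.integrable (by norm_num)) (integrable_const _)]; simp [hμ]
  obtain ⟨K, hK0, hK⟩ := exists_integral_rowSum_pow_four_le hlaw hind (hfm.sub_const μ) hgL hg0
  have hmean : ∀ n : ℕ, 0 < n → ∀ ω, (n : ℝ)⁻¹ * ∑ k, f (Z n k ω) - μ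
      = (n : ℝ)⁻¹ * ∑ k, g (Z n k ω) := fun n hn ω => by
    simp only [hg, Finset.sum_sub_distrib, Finset.sum_const, Finset.card_univ, Fintype.card_fin,
      nsmul_eq_mul]
    field_simp
  -- Markov's inequality for fourth powers gives probabilities of order `n⁻²`. These are summable,
  -- so the first Borel–Cantelli lemma applies without any relation between the rows.
  have key : ∀ j : ℕ, ∀ᵐ ω ∂P, ∀ᶠ n : ℕ in atTop,
      |(n : ℝ)⁻¹ * ∑ k, g (Z n k ω)| < 1 / ((j : ℝ) + 1) := by
    intro j
    set δ : ℝ := 1 / ((j : ℝ) + 1) with hδ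
    have hδ0 : 0 < δ := by positivity
    have hb : ∀ n : ℕ, 0 < n → P {ω | δ ≤ |(n : ℝ)⁻¹ * ∑ k, g (Z n k ω)|}
        ≤ ENNReal.ofReal (K / δ ^ 4 * (1 / (n : ℝ) ^ 2)) := by
      intro n hn
      have hn' : (0 : ℝ) < n := by exact_mod_cast hn
      have hm := mul_meas_ge_le_integral_of_nonneg (μ := P) (Eventually.of_forall fun ω => by positivity)
        (hK n).1 ((δ * n) ^ 4)
      have hsub : {ω | δ ≤ |(n : ℝ)⁻¹ * ∑ k, g (Z n k ω)|}
          ⊆ {ω | (δ * n) ^ 4 ≤ (∑ k, g (Z n k ω)) ^ 4} := by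
        intro ω hω
        simp only [Set.mem_ofPred_eq] at hω ⊢
        rw [abs_mul, abs_of_pos (inv_pos.2 hn'), inv_mul_eq_div, le_div_iff₀ hn'] at hω
        calc (δ * n) ^ 4 ≤ |∑ k, g (Z n k ω)| ^ 4 := pow_le_pow_left₀ (by positivity) hω 4
          _ = _ := by rw [← abs_pow]; exact abs_of_nonneg (by positivity)
      refine (measure_mono hsub).trans ?_
      rw [← ofReal_measureReal]
      refine ENNReal.ofReal_le_ofReal ?_
      have h2 := hm.trans (hK n).2
      rw [mul_comm, ← le_div_iff₀ (by positivity)] at h2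
      refine h2.trans (le_of_eq ?_)
      field_simp
    -- The shift to `n + 1` skips the empty row, about which `hb` says nothing.
    have hsum : ∑' n : ℕ, P {ω | δ ≤ |((n + 1 : ℕ) : ℝ)⁻¹ * ∑ k, g (Z (n + 1) k ω)|} ≠ ∞ := by
      refine ne_top_of_le_ne_top ?_ (ENNReal.tsum_le_tsum fun n => hb (n + 1) n.succ_pos)
      refine Summable.tsum_ofReal_ne_top ?_
      exact ((summable_nat_add_iff 1).2
        (Real.summable_one_div_nat_pow.2 one_lt_two)).mul_left _
    filter_upwards [ae_eventually_notMem hsum] with ω hω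
    obtain ⟨N, hN⟩ := eventually_atTop.1 hω
    refine eventually_atTop.2 ⟨N + 1, fun n hn => ?_⟩
    obtain ⟨n, rfl⟩ : ∃ k, n = k + 1 := ⟨n - 1, by lia⟩
    simpa using hN n (by lia)
  filter_upwards [ae_all_iff.2 key] with ω hω
  rw [Metric.tendsto_atTop']
  intro ε hε
  obtain ⟨j, hj⟩ := exists_nat_one_div_lt hε
  obtain ⟨N, hN⟩ := eventually_atTop.1 (hω j)
  refine ⟨N, fun n hn => ?_⟩
  rw [Real.dist_eq, hmean n (by lia)]
  exact (hN n hn.le).trans hj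

end TriangularArrays

/-! ### Bayes and minimax bounds in a Gaussian shift family. -/

section GaussianShift

variable {E : Type*} [NormedAddCommGroup E] [NormedSpace ℝ E] [MeasurableSpace E] [BorelSpace E]
  [SecondCountableTopology E] [CompleteSpace E]

/-- Bayes risk in a Gaussian shift family `t • b + ν` under a Gaussian prior on `t`. The functional
`ℓ` is the efficient estimator of `t`, and `s2` its variance. -/
lemma gaussianShift_bayesRisk_ge (ν : Measure E) [IsGaussian ν] {b : E} {ℓ : StrongDual ℝ E}
    (hb : ℓ b = 1) {s2 : ℝ} (hs : 0 < s2)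
    (hcov : ∀ L : StrongDual ℝ E, cov[L, ℓ; ν] = s2 * L b) {τ : NNReal} (hτ : 0 < τ)
    {δ : E → ℝ} (hδ : Measurable δ) (a : ℝ) :
    ENNReal.ofReal (a ^ 2 * (τ * s2 / (τ + s2))) ≤
      ∫⁻ t, ∫⁻ g, ENNReal.ofReal ((δ (t • b + g) - a * t) ^ 2) ∂ν ∂(gaussianReal 0 τ) := by
  have hτ' : (0 : ℝ) < τ := by exact_mod_cast hτ
  set μ := (gaussianReal 0 τ).prod ν with hμ
  -- `ρ` is the Bayes shrinkage factor. Since `ℓ b = 1`, the functional `e` below equals `t - ρ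
  -- ℓ(Z)`, the error of the posterior mean of `t` given the observation `Z = t b + g`.
  set ρ : ℝ := τ / (τ + s2) with hρ
  set e : ℝ × E →L[ℝ] ℝ := (1 - ρ) • ContinuousLinearMap.fst ℝ ℝ E
    - ρ • (ℓ.comp (ContinuousLinearMap.snd ℝ ℝ E)) with he
  set Z : ℝ × E →L[ℝ] E := (ContinuousLinearMap.fst ℝ ℝ E).smulRight b
    + ContinuousLinearMap.snd ℝ ℝ E with hZ
  have hid : HasGaussianLaw (id : ℝ × E → ℝ × E) μ := IsGaussian.hasGaussianLaw_id
  have hmem : ∀ L : StrongDual ℝ (ℝ × E), MemLp L 2 μ := fun L => (hid.map L).memLp_two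
  have hfst : MemLp (fun p : ℝ × E => p.1) 2 μ := hmem (ContinuousLinearMap.fst ℝ ℝ E)
  have hsnd : ∀ L : StrongDual ℝ E, MemLp (fun p : ℝ × E => L p.2) 2 μ := fun L =>
    hmem (L.comp (ContinuousLinearMap.snd ℝ ℝ E))
  have c11 : cov[fun p : ℝ × E => p.1, fun p => p.1; μ] = τ := by
    rw [covariance_self measurable_fst.aemeasurable]
    have := (measurePreserving_fst (μ := gaussianReal 0 τ) (ν := ν)).variance_fun_comp
      (f := fun x => x) aemeasurable_id
    rw [variance_fun_id_gaussianReal] at this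
    exact this
  have c12 : ∀ L : StrongDual ℝ E, cov[fun p : ℝ × E => p.1, fun p => L p.2; μ] = 0 := fun L =>
    covariance_fst_snd_prod (X := fun x => x) (memLp_id_gaussianReal 2) (IsGaussian.memLp_dual ν L 2 (by simp))
  have c22 : ∀ L : StrongDual ℝ E, cov[fun p : ℝ × E => ℓ p.2, fun p => L p.2; μ] = s2 * L b := by
    intro L
    rw [← hcov L, covariance_comm]
    have h : μ.map Prod.snd = ν := (measurePreserving_snd (μ := gaussianReal 0 τ) (ν := ν)).map_eq
    conv_rhs => rw [← h]
    rw [covariance_map_fun (by fun_prop) (by fun_prop) (by fun_prop)]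
  have hdenom : (τ : ℝ) + s2 ≠ 0 := by positivity
  -- By `hcov` this covariance is `L b * ((1 - ρ) τ - ρ s2)`, which the choice of `ρ` makes zero.
  -- Joint Gaussianity then turns it into independence of `e` and `Z`.
  have hcross : ∀ L : StrongDual ℝ E, cov[e, fun p => L (Z p); μ] = 0 := by
    intro L
    have h1 : (e : ℝ × E → ℝ) = (fun p => (1 - ρ) * p.1) - fun p => ρ * ℓ p.2 := by
      ext p; simp [he]
    have h2 : (fun p => L (Z p)) = (fun p : ℝ × E => L b * p.1) + fun p => L p.2 := by
      ext p; simp [hZ]; ring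
    rw [h1, h2, covariance_sub_left (hfst.const_mul _) ((hsnd ℓ).const_mul _)
        ((hfst.const_mul _).add (hsnd L)),
      covariance_add_right (hfst.const_mul _) (hfst.const_mul _) (hsnd L),
      covariance_add_right ((hsnd ℓ).const_mul _) (hfst.const_mul _) (hsnd L)]
    simp only [covariance_const_mul_left, covariance_const_mul_right]
    rw [c11, c12, c22, covariance_comm, c12, hρ]
    field_simp
    ring
  have hvar : Var[e; μ] = τ * s2 / (τ + s2) := by
    have h1 : (e : ℝ × E → ℝ) = (fun p => (1 - ρ) * p.1) - fun p => ρ * ℓ p.2 := by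
      ext p; simp [he]
    rw [← covariance_self e.continuous.aemeasurable]
    nth_rewrite 1 [h1]
    rw [covariance_sub_left (hfst.const_mul _) ((hsnd ℓ).const_mul _) (hmem e), h1,
      covariance_sub_right (hfst.const_mul _) (hfst.const_mul _) ((hsnd ℓ).const_mul _),
      covariance_sub_right ((hsnd ℓ).const_mul _) (hfst.const_mul _) ((hsnd ℓ).const_mul _)]
    simp only [covariance_const_mul_left, covariance_const_mul_right]
    rw [c11, c12, c22, covariance_comm, c12, hρ, hb]
    field_simp
    ring
  have hindep : IndepFun e Z μ := by
    refine HasGaussianLaw.indepFun_of_covariance_strongDual (hid.map (e.prod Z)) fun L₁ L₂ => ?_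
    have : L₁ ∘ e = fun p => L₁ 1 * e p := by
      ext p
      rw [Function.comp_apply, mul_comm, ← smul_eq_mul, ← map_smul, smul_eq_mul, mul_one]
    rw [this, covariance_const_mul_left]
    have := hcross L₂
    simp only [Function.comp_def]
    rw [this, mul_zero]
  -- The error of `δ` is `k(Z) - a e`, a sum of two independent terms. Its variance is therefore at
  -- least that of `a e`, whatever `δ` is.
  set k : E → ℝ := fun z => δ z - a * ρ * ℓ z with hk
  have hkm : Measurable k := hδ.sub (ℓ.continuous.measurable.const_mul _)
  set f : ℝ × E → ℝ := fun p => δ (p.1 • b + p.2) - a * p.1 with hf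
  have hfm : Measurable f := (hδ.comp (by fun_prop)).sub (by fun_prop)
  have hfk : f = (fun p => k (Z p)) + fun p => -a * e p := by
    ext p
    simp [hf, hk, he, hZ, hb]
    ring
  have hfint : ∫⁻ t, ∫⁻ g, ENNReal.ofReal ((δ (t • b + g) - a * t) ^ 2) ∂ν ∂(gaussianReal 0 τ)
      = ∫⁻ p, ENNReal.ofReal (f p ^ 2) ∂μ := by
    rw [hμ, lintegral_prod _ (by fun_prop)]
  rw [hfint]
  -- An infinite risk satisfies the bound trivially; a finite one makes the error square integrable,
  -- as additivity of variances requires.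
  by_cases htop : ∫⁻ p, ENNReal.ofReal (f p ^ 2) ∂μ = ∞
  · simp [htop]
  have hsq : Integrable (fun p => f p ^ 2) μ := by
    refine ⟨(hfm.pow_const 2).aestronglyMeasurable, ?_⟩
    rw [hasFiniteIntegral_iff_ofReal (Eventually.of_forall fun p => sq_nonneg _)]
    exact lt_top_iff_ne_top.2 htop
  have hfL : MemLp f 2 μ := (memLp_two_iff_integrable_sq hfm.aestronglyMeasurable).2 hsq
  have hkL : MemLp (fun p => k (Z p)) 2 μ := by
    have : (fun p => k (Z p)) = f - fun p => -a * e p := by rw [hfk]; simp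
    rw [this]
    exact hfL.sub ((hmem e).const_mul _)
  have hv : Var[f; μ] = Var[fun p => k (Z p); μ] + Var[fun p => -a * e p; μ] := by
    rw [hfk]
    refine IndepFun.variance_add hkL ((hmem e).const_mul _) ?_
    exact (hindep.symm.comp hkm (measurable_const_mul (-a)))
  rw [← ofReal_integral_eq_lintegral_ofReal hsq (Eventually.of_forall fun p => sq_nonneg _)]
  refine ENNReal.ofReal_le_ofReal ?_
  calc a ^ 2 * (τ * s2 / (τ + s2)) = Var[fun p => -a * e p; μ] := by
        rw [variance_const_mul, hvar]; ring
    _ ≤ Var[f; μ] := by rw [hv]; exact le_add_of_nonneg_left (variance_nonneg _ _)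
    _ ≤ ∫ p, f p ^ 2 ∂μ := variance_le_expectation_sq hfm.aestronglyMeasurable

/-- Minimax bound over `|t| ≤ M` in a Gaussian shift family, up to the tail of the prior. -/
lemma gaussianShift_minimax_ge (ν : Measure E) [IsGaussian ν] {b : E} {ℓ : StrongDual ℝ E}
    (hb : ℓ b = 1) {s2 : ℝ} (hs : 0 < s2)
    (hcov : ∀ L : StrongDual ℝ E, cov[L, ℓ; ν] = s2 * L b) {τ : NNReal} (hτ : 0 < τ)
    {δ : E → ℝ} (hδ : Measurable δ) (a : ℝ) {M : ℝ} (hM : 0 ≤ M) {R : ℝ≥0∞}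
    (hR : ∀ t : ℝ, |t| ≤ M → ∫⁻ g, ENNReal.ofReal ((δ (t • b + g) - a * t) ^ 2) ∂ν ≤ R) :
    ENNReal.ofReal (a ^ 2 * (τ * s2 / (τ + s2))) ≤
      R + ∫⁻ t in {t | M < |t|}, ENNReal.ofReal (4 * a ^ 2 * t ^ 2) ∂(gaussianReal 0 τ) := by
  -- Clipping to the range of `a * t` over `|t| ≤ M` cannot increase the error for such `t`, and for
  -- larger `|t|` it keeps the error below `2 |a t|`. The tail of the prior is thus controlled for
  -- an arbitrary `δ`.
  set δ' : E → ℝ := fun z => max (-(|a| * M)) (min (|a| * M) (δ z)) with hδ'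
  have hδ'm : Measurable δ' := measurable_const.max (measurable_const.min hδ)
  refine (gaussianShift_bayesRisk_ge ν hb hs hcov hτ hδ'm a).trans ?_
  have hms : MeasurableSet {t : ℝ | M < |t|} := measurableSet_lt measurable_const measurable_abs
  rw [← lintegral_add_compl _ hms, add_comm]
  gcongr ?_ + ?_
  · calc ∫⁻ t in {t | M < |t|}ᶜ, ∫⁻ g, ENNReal.ofReal ((δ' (t • b + g) - a * t) ^ 2) ∂ν
          ∂(gaussianReal 0 τ)
        ≤ ∫⁻ _ in {t : ℝ | M < |t|}ᶜ, R ∂(gaussianReal 0 τ) := by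
          refine setLIntegral_mono measurable_const fun t ht => ?_
          have ht' : |t| ≤ M := by simpa using ht
          refine le_trans (lintegral_mono fun g => ENNReal.ofReal_le_ofReal ?_) (hR t ht')
          have h1 : |a * t| ≤ |a| * M := by
            rw [abs_mul]; exact mul_le_mul_of_nonneg_left ht' (abs_nonneg a)
          obtain ⟨h2, h3⟩ := abs_le.1 h1
          refine sq_le_sq.2 ?_
          simp only [hδ']
          generalize δ (t • b + g) = y
          generalize |a| * M = r at *
          generalize a * t = x at *
          rcases max_cases (-r) (min r y) with h | h <;> rcases min_cases r y with h' | h' <;>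
            rw [abs_le] <;> rcases abs_cases (y - x) with h'' | h'' <;> constructor <;> linarith
      _ ≤ R := by
          rw [setLIntegral_const]
          exact mul_le_of_le_one_right' prob_le_one
  · refine setLIntegral_mono (by fun_prop) fun t ht => ?_
    have ht' : M < |t| := ht
    calc ∫⁻ g, ENNReal.ofReal ((δ' (t • b + g) - a * t) ^ 2) ∂ν
        ≤ ∫⁻ _, ENNReal.ofReal (4 * a ^ 2 * t ^ 2) ∂ν := by
          refine lintegral_mono fun g => ENNReal.ofReal_le_ofReal ?_
          have h1 : |a| * M ≤ |a * t| := by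
            rw [abs_mul]; exact mul_le_mul_of_nonneg_left ht'.le (abs_nonneg a)
          have h0 : 0 ≤ |a| * M := mul_nonneg (abs_nonneg a) hM
          have h4 : 4 * a ^ 2 * t ^ 2 = (2 * |a * t|) ^ 2 := by rw [mul_pow, sq_abs]; ring
          rw [h4]
          refine sq_le_sq' ?_ ?_
          all_goals
            simp only [hδ']
            generalize δ (t • b + g) = y
            generalize |a| * M = r at *
            generalize a * t = x at *
            rcases max_cases (-r) (min r y) with h | h <;> rcases min_cases r y with h' | h' <;>
              rcases abs_cases x with h'' | h'' <;> linarith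
      _ = _ := by simp

/-- The cost of localizing the prior vanishes: the tail sets decrease to the empty set and `t²` is
integrable. -/
lemma tendsto_setLIntegral_tail_gaussianReal (τ : NNReal) (K : ℝ) :
    Tendsto (fun M : ℝ => ∫⁻ t in {t | M < |t|}, ENNReal.ofReal (K * t ^ 2) ∂(gaussianReal 0 τ))
      atTop (nhds 0) := by
  have hms : ∀ M : ℝ, MeasurableSet {t : ℝ | M < |t|} := fun M =>
    measurableSet_lt measurable_const measurable_abs
  have hfint : Integrable (fun t : ℝ => K * t ^ 2) (gaussianReal 0 τ) :=
    ((memLp_two_iff_integrable_sq (by fun_prop)).1 (memLp_id_gaussianReal 2)).const_mul K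
  have hfin : ∫⁻ t, ENNReal.ofReal (K * t ^ 2) ∂(gaussianReal 0 τ) ≠ ∞ :=
    hfint.lintegral_lt_top.ne
  have h := tendsto_setLIntegral_zero (μ := gaussianReal 0 τ) (ι := ℝ) (l := atTop)
    (s := fun M : ℝ => {t : ℝ | M < |t|}) hfin ?_
  · exact h
  · have := tendsto_measure_iInter_atTop (μ := gaussianReal 0 τ) (s := fun M : ℝ => {t : ℝ | M < |t|})
      (fun M => (hms M).nullMeasurableSet)
      (fun M N hMN t ht => lt_of_le_of_lt hMN ht) ⟨0, measure_ne_top _ _⟩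
    convert this using 2
    rw [eq_comm, measure_eq_zero_iff_ae_notMem]
    refine Eventually.of_forall fun t ht => ?_
    exact lt_irrefl |t| (show |t| < |t| from Set.mem_iInter.1 ht |t|)

end GaussianShift

/-! ### Domination between Gaussian measures of different variance. -/

section GaussianComparison

/-- The comparison is pointwise between densities. The exponentials are ordered because `v' ≤ v`,
and the normalizing constants differ by the factor `√(v / v') ≤ r`. -/
lemma gaussianReal_le_of_var_le {v v' : NNReal} {r : ℝ} (hv' : 0 < v') (hr : 0 < r) (h : v' ≤ v)
    (h' : (v : ℝ) ≤ r ^ 2 * v') :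
    ENNReal.ofReal r⁻¹ • gaussianReal 0 v' ≤ gaussianReal 0 v := by
  have hv : 0 < v := hv'.trans_le h
  have hvR : (0 : ℝ) < v := by exact_mod_cast hv
  have hvR' : (0 : ℝ) < v' := by exact_mod_cast hv'
  have hle : (v' : ℝ) ≤ v := by exact_mod_cast h
  rw [gaussianReal_of_var_ne_zero 0 hv.ne', gaussianReal_of_var_ne_zero 0 hv'.ne',
    ← withDensity_smul _ (measurable_gaussianPDF 0 v')]
  refine withDensity_mono (Eventually.of_forall fun x => ?_)
  simp only [Pi.smul_apply, smul_eq_mul, gaussianPDF]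
  rw [← ENNReal.ofReal_mul (by positivity)]
  refine ENNReal.ofReal_le_ofReal ?_
  simp only [gaussianPDFReal, sub_zero]
  rw [← mul_assoc, ← mul_inv]
  have h1 : √(2 * Real.pi * v) ≤ r * √(2 * Real.pi * v') := by
    rw [← Real.sqrt_sq hr.le, ← Real.sqrt_mul (by positivity)]
    refine Real.sqrt_le_sqrt ?_
    nlinarith [Real.pi_pos]
  gcongr ?_ * ?_
  · exact inv_anti₀ (by positivity) h1
  · refine Real.exp_le_exp.2 ?_
    rw [neg_div, neg_div, neg_le_neg_iff]
    gcongr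

/-- An inequality on boxes does not in general pass to all measurable sets. Here it does, because
the outer measure behind `Measure.pi` is the largest one bounded on boxes by the products. -/
lemma Measure.pi_smul_le_pi {ι : Type*} [Fintype ι] {α : ι → Type*} [∀ i, MeasurableSpace (α i)]
    {μ ν : (i : ι) → Measure (α i)} [∀ i, IsProbabilityMeasure (μ i)]
    [∀ i, IsProbabilityMeasure (ν i)] {c : ι → ℝ≥0∞} (h : ∀ i, c i • ν i ≤ μ i) :
    (∏ i, c i) • Measure.pi ν ≤ Measure.pi μ := by
  have key : ((∏ i, c i) • Measure.pi ν).toOuterMeasure ≤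
      OuterMeasure.pi fun i => (μ i).toOuterMeasure := by
    rw [OuterMeasure.le_pi]
    intro s _
    have hs : ((∏ i, c i) • Measure.pi ν) (Set.univ.pi s) ≤ ∏ i, μ i (s i) := by
      rw [Measure.smul_apply, Measure.pi_pi, smul_eq_mul, ← Finset.prod_mul_distrib]
      exact Finset.prod_le_prod' fun i _ => h i (s i)
    exact hs
  refine Measure.le_iff.2 fun s hs => ?_
  refine (key s).trans_eq ?_
  rw [Measure.pi, toMeasure_apply _ _ hs]

lemma map_const_add_mul_stdGaussian {n : ℕ} (c : Fin n → ℝ) {v : ℝ} (hv : 0 ≤ v) :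
    (stdGaussian (EuclideanSpace ℝ (Fin n))).map (fun g k => c k + √v * g k)
      = Measure.pi fun k => gaussianReal (c k) v.toNNReal := by
  rw [← map_pi_eq_stdGaussian, Measure.map_map (by fun_prop) (by fun_prop)]
  have : (fun (g : EuclideanSpace ℝ (Fin n)) k => c k + √v * g k) ∘ WithLp.toLp 2
      = fun (g : Fin n → ℝ) k => (fun x => c k + √v * x) (g k) := rfl
  rw [this, Measure.pi_map_pi (f := fun k x => c k + √v * x) (fun k => by fun_prop)]
  congr 1
  ext1 k
  have h2 : (fun x => c k + √v * x) = (fun x => c k + x) ∘ (fun x => √v * x) := rfl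
  rw [h2, ← Measure.map_map (by fun_prop) (by fun_prop), gaussianReal_map_const_mul,
    gaussianReal_map_const_add]
  congr 1
  · ring
  · ext; simp [Real.sq_sqrt hv, hv]

lemma stdGaussian_map_smul_le {p : ℕ} {v v' r : ℝ} (hv' : 0 < v') (hr : 0 < r) (h : v' ≤ v)
    (h' : v ≤ r ^ 2 * v') :
    (ENNReal.ofReal r⁻¹) ^ p • (stdGaussian (EuclideanSpace ℝ (Fin p))).map (fun g => √v' • g)
      ≤ (stdGaussian (EuclideanSpace ℝ (Fin p))).map (fun g => √v • g) := by
  have key : ∀ w : ℝ, 0 ≤ w → (stdGaussian (EuclideanSpace ℝ (Fin p))).map (fun g => √w • g)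
      = (Measure.pi fun _ : Fin p => gaussianReal 0 w.toNNReal).map (WithLp.toLp 2) := by
    intro w hw
    rw [← map_const_add_mul_stdGaussian (fun _ => 0) hw, Measure.map_map (by fun_prop) (by fun_prop)]
    congr 1
    ext g k
    simp
  rw [key v' hv'.le, key v (hv'.le.trans h), ← Measure.map_smul]
  refine Measure.map_mono ?_ (by fun_prop)
  have := Measure.pi_smul_le_pi (ι := Fin p) (μ := fun _ => gaussianReal 0 v.toNNReal)
    (ν := fun _ => gaussianReal 0 v'.toNNReal) (c := fun _ => ENNReal.ofReal r⁻¹) fun _ =>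
      gaussianReal_le_of_var_le (Real.toNNReal_pos.2 hv') hr (Real.toNNReal_le_toNNReal h)
        (by rw [Real.coe_toNNReal _ hv'.le, Real.coe_toNNReal _ (hv'.le.trans h)]; exact h')
  simpa using this

end GaussianComparison

/-! ### Matrices acting on Euclidean spaces and on Gaussian measures. -/

section EuclideanMatrices

lemma euclMul_apply {p q : ℕ} (A : Matrix (Fin p) (Fin q) ℝ) (v : EuclideanSpace ℝ (Fin q)) :
    (euclMul A v).ofLp = A *ᵥ v.ofLp := rfl

lemma real_inner_eq_dotProduct {p : ℕ} (x y : EuclideanSpace ℝ (Fin p)) :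
    inner ℝ x y = x.ofLp ⬝ᵥ y.ofLp := by
  rw [EuclideanSpace.inner_eq_star_dotProduct, dotProduct_comm]; simp

lemma inner_euclMul {p q : ℕ} (A : Matrix (Fin p) (Fin q) ℝ) (x : EuclideanSpace ℝ (Fin q))
    (y : EuclideanSpace ℝ (Fin p)) : inner ℝ (euclMul A x) y = inner ℝ x (euclMul Aᵀ y) := by
  simp only [real_inner_eq_dotProduct, euclMul_apply]
  rw [dotProduct_mulVec, vecMul_transpose]

lemma continuous_euclMul {p q : ℕ} (A : Matrix (Fin p) (Fin q) ℝ) : Continuous (euclMul A) := by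
  unfold euclMul
  fun_prop

@[fun_prop]
lemma measurable_euclMul {p q : ℕ} (A : Matrix (Fin p) (Fin q) ℝ) : Measurable (euclMul A) :=
  (continuous_euclMul A).measurable

lemma euclMul_add {p q : ℕ} (A : Matrix (Fin p) (Fin q) ℝ) (x y : EuclideanSpace ℝ (Fin q)) :
    euclMul A (x + y) = euclMul A x + euclMul A y := by
  ext k; simp [euclMul, mulVec_add]

lemma euclMul_sub {p q : ℕ} (A : Matrix (Fin p) (Fin q) ℝ) (x y : EuclideanSpace ℝ (Fin q)) :
    euclMul A (x - y) = euclMul A x - euclMul A y := by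
  ext k; simp [euclMul, mulVec_sub]

lemma euclMul_smul {p q : ℕ} (A : Matrix (Fin p) (Fin q) ℝ) (c : ℝ)
    (x : EuclideanSpace ℝ (Fin q)) : euclMul A (c • x) = c • euclMul A x := by
  ext k; simp [euclMul, mulVec_smul]

lemma euclMul_euclMul {p q r : ℕ} (A : Matrix (Fin p) (Fin q) ℝ) (B : Matrix (Fin q) (Fin r) ℝ)
    (x : EuclideanSpace ℝ (Fin r)) : euclMul A (euclMul B x) = euclMul (A * B) x := by
  ext k; simp [euclMul, mulVec_mulVec]

lemma euclMul_one {p : ℕ} (x : EuclideanSpace ℝ (Fin p)) :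
    euclMul (1 : Matrix (Fin p) (Fin p) ℝ) x = x := by
  ext k; simp [euclMul]

/-- The image of a centred Gaussian under a matrix. -/
lemma multivariateGaussian_map_euclMul {p q : ℕ} (A : Matrix (Fin p) (Fin q) ℝ)
    {K : Matrix (Fin q) (Fin q) ℝ} (hK : K.PosSemidef) :
    (multivariateGaussian 0 K).map (euclMul A) = multivariateGaussian 0 (A * K * Aᵀ) := by
  have hK' : (A * K * Aᵀ).PosSemidef := by
    simpa using hK.mul_mul_conjTranspose_same A
  have : IsProbabilityMeasure ((multivariateGaussian 0 K).map (euclMul A)) :=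
    Measure.isProbabilityMeasure_map (by fun_prop)
  refine Measure.ext_of_charFun ?_
  ext t
  have h1 : charFun ((multivariateGaussian 0 K).map (euclMul A)) t
      = charFun (multivariateGaussian 0 K) (euclMul Aᵀ t) := by
    rw [charFun_apply, charFun_apply, integral_map (by fun_prop)
      (Measurable.aestronglyMeasurable (by fun_prop))]
    simp_rw [inner_euclMul]
  rw [h1, charFun_multivariateGaussian hK, charFun_multivariateGaussian hK']
  simp only [inner_zero_right, euclMul_apply]
  congr 4
  rw [← mulVec_mulVec, ← mulVec_mulVec, dotProduct_mulVec _ A, ← mulVec_transpose]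

lemma stdGaussian_map_euclMul {p q : ℕ} (A : Matrix (Fin p) (Fin q) ℝ) :
    (stdGaussian (EuclideanSpace ℝ (Fin q))).map (euclMul A)
      = multivariateGaussian 0 (A * Aᵀ) := by
  rw [← multivariateGaussian_zero_one, multivariateGaussian_map_euclMul A .one, Matrix.mul_one]

lemma multivariateGaussian_map_sqrt_smul {p : ℕ} {K : Matrix (Fin p) (Fin p) ℝ}
    (hK : K.PosSemidef) {v : ℝ} (hv : 0 ≤ v) :
    (multivariateGaussian 0 K).map (fun g => √v • g) = multivariateGaussian 0 (v • K) := by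
  have h : (fun g : EuclideanSpace ℝ (Fin p) => √v • g) = euclMul (√v • (1 : Matrix _ _ ℝ)) := by
    ext g k; simp [euclMul, smul_mulVec]
  rw [h, multivariateGaussian_map_euclMul _ hK]
  congr 1
  simp [smul_smul, Real.mul_self_sqrt hv]

open scoped MatrixOrder in
/-- Shrinking the covariance of a Gaussian by a factor costs only a constant factor. -/
lemma multivariateGaussian_le_of_smul {p : ℕ} {K : Matrix (Fin p) (Fin p) ℝ}
    (hK : K.PosSemidef) {v v' r : ℝ} (hv' : 0 < v') (hr : 0 < r) (h : v' ≤ v)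
    (h' : v ≤ r ^ 2 * v') :
    (ENNReal.ofReal r⁻¹) ^ p • multivariateGaussian 0 (v' • K) ≤ multivariateGaussian 0 (v • K) := by
  rw [← multivariateGaussian_map_sqrt_smul hK hv'.le,
    ← multivariateGaussian_map_sqrt_smul hK (hv'.le.trans h)]
  -- Both measures are images of scaled standard Gaussians under the same map `CFC.sqrt K`, and
  -- images preserve domination. No density is needed, so `K` may be singular.
  have key : ∀ w : ℝ, (multivariateGaussian 0 K).map (fun g => √w • g)
      = ((stdGaussian (EuclideanSpace ℝ (Fin p))).map (fun g => √w • g)).map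
        (toEuclideanCLM (𝕜 := ℝ) (CFC.sqrt K)) := by
    intro w
    rw [multivariateGaussian, Measure.map_map (by fun_prop) (by fun_prop),
      Measure.map_map (by fun_prop) (by fun_prop)]
    congr 1
    ext1 g
    simp
  rw [key, key, ← Measure.map_smul]
  exact Measure.map_mono (stdGaussian_map_smul_le hv' hr h h') (by fun_prop)

end EuclideanMatrices

/-! ### Law of the local least squares estimates for a fixed design. -/

namespace Views

variable {m d : ℕ} (V : Views m d) {S : Matrix (Fin d) (Fin d) ℝ} {σ : ℝ}

/-- The variance `ϑ_{i-}ᵀ Γ_{i-} ϑ_{i-} + σ²` of a label of agent `i` given its observed features. -/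
noncomputable def labelVar (S : Matrix (Fin d) (Fin d) ℝ) (σ : ℝ) (ϑ : EuclideanSpace ℝ (Fin d))
    (i : Fin m) : ℝ :=
  (V.minus i ϑ).ofLp ⬝ᵥ V.schur S i *ᵥ (V.minus i ϑ).ofLp + σ ^ 2

lemma blockPP_posDef (hS : S.PosDef) (i : Fin m) : (V.blockPP i S).PosDef :=
  hS.submatrix fun a b hab => by simpa using (V.view i).injective hab

lemma blockMP_eq_transpose (hS : S.PosDef) (i : Fin m) : V.blockMP i S = (V.blockPM i S)ᵀ := by
  ext a b
  have := hS.isHermitian.apply (V.view i (Sum.inr a)) (V.view i (Sum.inl b))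
  simpa [blockMP, blockPM] using this.symm

/-- Reordering the coordinates by `view i` turns `S` into a block matrix, to which the Schur
complement criterion applies. -/
lemma schur_posSemidef (hS : S.PosDef) (i : Fin m) : (V.schur S i).PosSemidef := by
  have hA := V.blockPP_posDef hS i
  have hunit : Invertible (V.blockPP i S) := hA.isUnit.invertible
  have h := (Matrix.PosDef.fromBlocks₁₁ (V.blockPM i S) (V.blockMM i S) hA).1 ?_
  · rw [schur, V.blockMP_eq_transpose hS]
    simpa using h
  · have h2 := (hS.posSemidef.submatrix (V.view i))
    have h3 : Matrix.fromBlocks (V.blockPP i S) (V.blockPM i S) (V.blockPM i S)ᴴ (V.blockMM i S)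
        = S.submatrix (V.view i) (V.view i) := by
      ext s t
      rcases s with a | a <;> rcases t with b | b
      · rfl
      · rfl
      · exact hS.isHermitian.apply (V.view i (Sum.inr a)) (V.view i (Sum.inl b))
      · rfl
    rw [h3]
    exact h2

lemma labelVar_pos (hS : S.PosDef) (hσ : 0 < σ) (ϑ : EuclideanSpace ℝ (Fin d)) (i : Fin m) :
    0 < V.labelVar S σ ϑ i := by
  have := (V.schur_posSemidef hS i).dotProduct_mulVec_nonneg (V.minus i ϑ).ofLp
  simp only [star_trivial] at this
  unfold labelVar
  positivity

lemma continuous_labelVar (i : Fin m) : Continuous fun ϑ => V.labelVar S σ ϑ i := by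
  unfold labelVar minus
  fun_prop

lemma euclMul_transfer (i : Fin m) (ϑ : EuclideanSpace ℝ (Fin d)) :
    euclMul (V.transfer S i) ϑ
      = V.plus i ϑ + euclMul ((V.blockPP i S)⁻¹ * V.blockPM i S) (V.minus i ϑ) := by
  ext a
  simp only [euclMul, transfer, mulVec, dotProduct, plus, minus, PiLp.add_apply]
  rw [← (V.view i).sum_comp]
  simp [Fintype.sum_sum_type, Matrix.one_apply]

/-- This is how `T_i` enters the model: once the missing features are averaged out, the regression
coefficient on the observed ones is `T_i ϑ`. -/
lemma inner_conditionalMean (hS : S.PosDef) (i : Fin m) (x : EuclideanSpace ℝ (Fin (V.obs i)))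
    (ϑ : EuclideanSpace ℝ (Fin d)) :
    inner ℝ x (V.plus i ϑ)
        + inner ℝ (euclMul (V.blockMP i S * (V.blockPP i S)⁻¹) x) (V.minus i ϑ)
      = inner ℝ x (euclMul (V.transfer S i) ϑ) := by
  have hsymm : ((V.blockPP i S)⁻¹)ᵀ = (V.blockPP i S)⁻¹ := by
    have := (V.blockPP_posDef hS i).isHermitian
    rw [transpose_nonsing_inv]
    congr 1
  rw [inner_euclMul, V.euclMul_transfer, inner_add_right, transpose_mul, hsymm,
    V.blockMP_eq_transpose hS, transpose_transpose]

end Views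

lemma multivariateGaussian_map_inner {p : ℕ} (μ : EuclideanSpace ℝ (Fin p))
    {K : Matrix (Fin p) (Fin p) ℝ} (hK : K.PosSemidef) (w : EuclideanSpace ℝ (Fin p)) :
    (multivariateGaussian μ K).map (fun x => inner ℝ x w)
      = gaussianReal (inner ℝ μ w) (w.ofLp ⬝ᵥ K *ᵥ w.ofLp).toNNReal := by
  have h : (fun x => inner ℝ x w) = (innerSL ℝ w : EuclideanSpace ℝ (Fin p) → ℝ) := by
    ext x; simp [real_inner_comm]
  rw [h, IsGaussian.map_eq_gaussianReal]
  congr 1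
  · rw [ContinuousLinearMap.integral_comp_id_comm]
    · simp [real_inner_comm]
    · exact IsGaussian.integrable_id
  · congr 1
    rw [← covarianceBilin_multivariateGaussian (μ := μ) hK w w,
      covarianceBilin_self IsGaussian.memLp_two_id]
    rfl

namespace Views

variable {m d : ℕ} (V : Views m d) {S : Matrix (Fin d) (Fin d) ℝ} {σ : ℝ}

instance (i : Fin m) (x : EuclideanSpace ℝ (Fin (V.obs i))) :
    IsProbabilityMeasure (V.hiddenRowLaw S σ i x) := by
  unfold hiddenRowLaw; infer_instance

/-- The law of a label given the observed features. -/
lemma map_label_hiddenRowLaw (hS : S.PosDef) (i : Fin m) (x : EuclideanSpace ℝ (Fin (V.obs i)))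
    (ϑ : EuclideanSpace ℝ (Fin d)) :
    (V.hiddenRowLaw S σ i x).map
        (fun h => inner ℝ x (V.plus i ϑ) + inner ℝ h.1 (V.minus i ϑ) + h.2)
      = gaussianReal (inner ℝ x (euclMul (V.transfer S i) ϑ)) (V.labelVar S σ ϑ i).toNNReal := by
  have hΓ := V.schur_posSemidef hS i
  set c := inner ℝ x (V.plus i ϑ) with hc
  have h : (fun h : EuclideanSpace ℝ (Fin (V.hid i)) × ℝ => c + inner ℝ h.1 (V.minus i ϑ) + h.2)
      = (fun y => c + y) ∘ (fun q : ℝ × ℝ => q.1 + q.2)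
        ∘ Prod.map (fun z => inner ℝ z (V.minus i ϑ)) id := by
    ext h; simp [add_assoc]
  rw [h, ← Measure.map_map (by fun_prop) (by fun_prop), ← Measure.map_map (by fun_prop) (by fun_prop),
    hiddenRowLaw, ← Measure.map_prod_map _ _ (by fun_prop) measurable_id, Measure.map_id,
    multivariateGaussian_map_inner _ hΓ]
  change ((gaussianReal _ _) ∗ (gaussianReal _ _)).map _ = _
  rw [gaussianReal_conv_gaussianReal, gaussianReal_map_const_add]
  congr 1
  · rw [add_zero, add_comm, V.inner_conditionalMean hS]
  · have := hΓ.dotProduct_mulVec_nonneg (V.minus i ϑ).ofLp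
    simp only [star_trivial] at this
    rw [labelVar, Real.toNNReal_add this (sq_nonneg σ)]

/-- The law of the least squares estimate of one agent, for a fixed observed design. -/
lemma map_olsEstimate (hS : S.PosDef) (hσ : 0 < σ) {n : ℕ} (i : Fin m)
    (X : Fin n → EuclideanSpace ℝ (Fin (V.obs i))) (ϑ : EuclideanSpace ℝ (Fin d))
    (hX : IsUnit ((Matrix.of fun k => (X k).ofLp)ᵀ * Matrix.of fun k => (X k).ofLp)) :
    (Measure.pi fun k => V.hiddenRowLaw S σ i (X k)).map
        (fun h => olsEstimate (Matrix.of fun k => (X k).ofLp) (V.fixedLabels ϑ i X h))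
      = (multivariateGaussian 0 (V.labelVar S σ ϑ i •
          ((Matrix.of fun k => (X k).ofLp)ᵀ * Matrix.of fun k => (X k).ofLp)⁻¹)).map
        (fun g => euclMul (V.transfer S i) ϑ + g) := by
  set A : Matrix (Fin n) (Fin (V.obs i)) ℝ := Matrix.of fun k => (X k).ofLp with hA
  have hdet : IsUnit (Aᵀ * A).det := (Matrix.isUnit_iff_isUnit_det _).1 hX
  have hv := V.labelVar_pos hS hσ ϑ i
  set v := V.labelVar S σ ϑ i with hvdef
  set T := V.transfer S i
  have holsm : Measurable (olsEstimate A) := by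
    unfold olsEstimate; fun_prop
  have hols : ∀ g : EuclideanSpace ℝ (Fin n),
      olsEstimate A (fun k => inner ℝ (X k) (euclMul T ϑ) + √v * g k)
        = euclMul T ϑ + √v • euclMul ((Aᵀ * A)⁻¹ * Aᵀ) g := by
    intro g
    have h1 : (fun k => inner ℝ (X k) (euclMul T ϑ) + √v * g k)
        = A *ᵥ (euclMul T ϑ).ofLp + √v • g.ofLp := by
      ext k
      simp [real_inner_eq_dotProduct, hA, mulVec]
    rw [h1]
    ext a
    simp only [olsEstimate, mulVec_add, mulVec_smul, mulVec_mulVec, ← Matrix.mul_assoc]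
    rw [Matrix.mul_assoc _ Aᵀ A, nonsing_inv_mul _ hdet, one_mulVec]
    simp [euclMul]
  have hlab : (Measure.pi fun k => V.hiddenRowLaw S σ i (X k)).map (V.fixedLabels ϑ i X)
      = (stdGaussian (EuclideanSpace ℝ (Fin n))).map
        (fun g k => inner ℝ (X k) (euclMul T ϑ) + √v * g k) := by
    rw [map_const_add_mul_stdGaussian _ hv.le]
    have h2 : (fun k => gaussianReal (inner ℝ (X k) (euclMul T ϑ)) v.toNNReal)
        = fun k => (V.hiddenRowLaw S σ i (X k)).map
          (fun h => inner ℝ (X k) (V.plus i ϑ) + inner ℝ h.1 (V.minus i ϑ) + h.2) :=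
      funext fun k => (V.map_label_hiddenRowLaw hS i (X k) ϑ).symm
    rw [h2, ← Measure.pi_map_pi (fun k => by fun_prop)]
    rfl
  have hlm : Measurable (V.fixedLabels ϑ i X) := by
    unfold fixedLabels; fun_prop
  have hgram : ((Aᵀ * A)⁻¹).PosSemidef := by
    have := (posSemidef_conjTranspose_mul_self A).inv
    simpa using this
  have hcov : (Aᵀ * A)⁻¹ * Aᵀ * ((Aᵀ * A)⁻¹ * Aᵀ)ᵀ = (Aᵀ * A)⁻¹ := by
    rw [transpose_mul, transpose_transpose, transpose_nonsing_inv, transpose_mul,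
      transpose_transpose, Matrix.mul_assoc, ← Matrix.mul_assoc Aᵀ, mul_nonsing_inv _ hdet,
      Matrix.mul_one]
  calc (Measure.pi fun k => V.hiddenRowLaw S σ i (X k)).map
          (fun h => olsEstimate A (V.fixedLabels ϑ i X h))
      = ((Measure.pi fun k => V.hiddenRowLaw S σ i (X k)).map (V.fixedLabels ϑ i X)).map
          (olsEstimate A) := by rw [Measure.map_map holsm hlm]; rfl
    _ = (stdGaussian (EuclideanSpace ℝ (Fin n))).map
          (fun g => euclMul T ϑ + √v • euclMul ((Aᵀ * A)⁻¹ * Aᵀ) g) := by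
        rw [hlab, Measure.map_map holsm (by fun_prop)]
        congr 1
        ext1 g
        exact hols g
    _ = (((stdGaussian (EuclideanSpace ℝ (Fin n))).map (euclMul ((Aᵀ * A)⁻¹ * Aᵀ))).map
          (fun g => √v • g)).map (fun g => euclMul T ϑ + g) := by
        rw [Measure.map_map (by fun_prop) (by fun_prop), Measure.map_map (by fun_prop) (by fun_prop)]
        rfl
    _ = _ := by
        rw [stdGaussian_map_euclMul, hcov, multivariateGaussian_map_sqrt_smul hgram hv.le]

/-- The joint law of the least squares estimates dominates, up to a constant, a Gaussian shift
family with constant covariance. -/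
lemma le_olsLaw (hS : S.PosDef) (hσ : 0 < σ) {n : ℕ}
    (X : (i : Fin m) → Fin n → EuclideanSpace ℝ (Fin (V.obs i))) (ϑ : EuclideanSpace ℝ (Fin d))
    (hX : ∀ i, IsUnit ((Matrix.of fun k => (X i k).ofLp)ᵀ * Matrix.of fun k => (X i k).ofLp))
    {v : Fin m → ℝ} {r : ℝ} (hr : 0 < r) (hv : ∀ i, 0 < v i)
    (h : ∀ i, v i ≤ V.labelVar S σ ϑ i) (h' : ∀ i, V.labelVar S σ ϑ i ≤ r ^ 2 * v i) :
    (∏ i, (ENNReal.ofReal r⁻¹) ^ V.obs i) •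
      (Measure.pi fun i => multivariateGaussian 0 (v i •
          ((Matrix.of fun k => (X i k).ofLp)ᵀ * Matrix.of fun k => (X i k).ofLp)⁻¹)).map
        (fun g i => euclMul (V.transfer S i) ϑ + g i) ≤ V.olsLaw S σ X ϑ := by
  have hm : ∀ i, Measurable fun h : Fin n → EuclideanSpace ℝ (Fin (V.hid i)) × ℝ =>
      olsEstimate (Matrix.of fun k => (X i k).ofLp) (V.fixedLabels ϑ i (X i) h) := by
    intro i
    unfold olsEstimate fixedLabels
    fun_prop
  have h1 : V.olsLaw S σ X ϑ = (Measure.pi fun i => multivariateGaussian 0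
      (V.labelVar S σ ϑ i •
        ((Matrix.of fun k => (X i k).ofLp)ᵀ * Matrix.of fun k => (X i k).ofLp)⁻¹)).map
        (fun g i => euclMul (V.transfer S i) ϑ + g i) := by
    rw [olsLaw, Measure.pi_map_pi (f := fun i h => olsEstimate (Matrix.of fun k => (X i k).ofLp)
      (V.fixedLabels ϑ i (X i) h)) (fun i => (hm i).aemeasurable)]
    simp_rw [fun i => V.map_olsEstimate hS hσ i (X i) ϑ (hX i)]
    rw [Measure.pi_map_pi (f := fun i g => euclMul (V.transfer S i) ϑ + g)
      (fun i => by fun_prop)]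
  rw [h1, ← Measure.map_smul]
  -- The measures compared live on the estimates, whose total dimension is fixed. The constant is
  -- therefore free of `n`, whereas the same comparison between label vectors would cost a power
  -- growing with `n`.
  refine Measure.map_mono (Measure.pi_smul_le_pi fun i => ?_) (by fun_prop)
  refine multivariateGaussian_le_of_smul ?_ (hv i) hr (h i) (h' i)
  have := (posSemidef_conjTranspose_mul_self (Matrix.of fun k => (X i k).ofLp)).inv
  simpa using this

end Views

/-! ### Products of Gaussian measures over the agents. -/

section PiGaussian

variable {m : ℕ} {p : Fin m → ℕ}

instance isGaussian_pi_multivariateGaussian (K : (i : Fin m) → Matrix (Fin (p i)) (Fin (p i)) ℝ) :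
    IsGaussian (Measure.pi fun i => multivariateGaussian 0 (K i)) := by
  set ν := Measure.pi fun i => multivariateGaussian 0 (K i)
  have hi : ∀ i, HasGaussianLaw (fun z : (i : Fin m) → EuclideanSpace ℝ (Fin (p i)) => z i) ν := by
    intro i
    have h : ν.map (fun z => z i) = multivariateGaussian 0 (K i) :=
      (measurePreserving_eval (fun i => multivariateGaussian 0 (K i)) i).map_eq
    exact ⟨by rw [h]; infer_instance⟩
  have hind : iIndepFun (fun i (z : (i : Fin m) → EuclideanSpace ℝ (Fin (p i))) => z i) ν :=
    iIndepFun_pi (X := fun i => id) (fun i => aemeasurable_id)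
  have := (iIndepFun.hasGaussianLaw hi hind).isGaussian_map
  simpa using this

lemma exists_eq_sum_inner (L : StrongDual ℝ ((i : Fin m) → EuclideanSpace ℝ (Fin (p i)))) :
    ∃ x : (i : Fin m) → EuclideanSpace ℝ (Fin (p i)), ∀ z, L z = ∑ i, inner ℝ (x i) (z i) := by
  classical
  refine ⟨fun i => (InnerProductSpace.toDual ℝ _).symm
    (L.comp (ContinuousLinearMap.single ℝ (fun i => EuclideanSpace ℝ (Fin (p i))) i)), fun z => ?_⟩
  conv_lhs => rw [← Finset.univ_sum_single z]
  rw [map_sum]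
  refine Finset.sum_congr rfl fun i _ => ?_
  rw [InnerProductSpace.toDual_symm_apply, ContinuousLinearMap.comp_apply]
  rfl

/-- Independence kills the cross terms between agents. The form is that of `hcov` in
`gaussianShift_bayesRisk_ge`: choosing `y` so that `K y` is proportional to the shift `b` produces
the efficient functional. -/
lemma covariance_pi_multivariateGaussian {K : (i : Fin m) → Matrix (Fin (p i)) (Fin (p i)) ℝ}
    (hK : ∀ i, (K i).PosSemidef) (y : (i : Fin m) → EuclideanSpace ℝ (Fin (p i)))
    (L : StrongDual ℝ ((i : Fin m) → EuclideanSpace ℝ (Fin (p i)))) :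
    cov[L, fun z => ∑ i, inner ℝ (y i) (z i); Measure.pi fun i => multivariateGaussian 0 (K i)]
      = L fun i => euclMul (K i) (y i) := by
  classical
  set ν := Measure.pi fun i => multivariateGaussian 0 (K i) with hν
  obtain ⟨x, hL⟩ := exists_eq_sum_inner L
  have hmp : ∀ i, MeasurePreserving (fun z : (i : Fin m) → EuclideanSpace ℝ (Fin (p i)) => z i) ν
      (multivariateGaussian 0 (K i)) := fun i =>
    measurePreserving_eval (fun i => multivariateGaussian 0 (K i)) i
  have hmem0 : ∀ i (w : EuclideanSpace ℝ (Fin (p i))),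
      MemLp (fun z => inner ℝ w z) 2 (multivariateGaussian 0 (K i)) := fun i w =>
    IsGaussian.memLp_dual _ (innerSL ℝ w) 2 (by simp)
  have hmem : ∀ i (w : EuclideanSpace ℝ (Fin (p i))),
      MemLp (fun z : (i : Fin m) → EuclideanSpace ℝ (Fin (p i)) => inner ℝ w (z i)) 2 ν :=
    fun i w => (hmem0 i w).comp_measurePreserving (hmp i)
  have hind : iIndepFun (fun i (z : (i : Fin m) → EuclideanSpace ℝ (Fin (p i))) => z i) ν :=
    iIndepFun_pi (X := fun i => id) (fun i => aemeasurable_id)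
  have hLf : (L : ((i : Fin m) → EuclideanSpace ℝ (Fin (p i))) → ℝ)
      = fun z => ∑ i, inner ℝ (x i) (z i) := funext hL
  have hsum := covariance_fun_sum_fun_sum (μ := ν)
    (X := fun i (z : (i : Fin m) → EuclideanSpace ℝ (Fin (p i))) => inner ℝ (x i) (z i))
    (Y := fun i (z : (i : Fin m) → EuclideanSpace ℝ (Fin (p i))) => inner ℝ (y i) (z i))
    (fun i => hmem i _) (fun i => hmem i _)
  rw [hLf, hsum, ← hLf, hL]
  refine Finset.sum_congr rfl fun i _ => ?_
  rw [Finset.sum_eq_single i]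
  · have h1 : cov[fun z : (i : Fin m) → EuclideanSpace ℝ (Fin (p i)) => inner ℝ (x i) (z i),
        fun z => inner ℝ (y i) (z i); ν]
        = cov[fun z => inner ℝ (x i) z, fun z => inner ℝ (y i) z; multivariateGaussian 0 (K i)] :=
      (hmp i).hasLaw.covariance_fun_comp (by fun_prop) (by fun_prop)
    rw [h1, ← covarianceBilin_apply_eq_cov IsGaussian.memLp_two_id,
      covarianceBilin_multivariateGaussian (hK i), real_inner_eq_dotProduct]
    rfl
  · intro j _ hj
    refine IndepFun.covariance_eq_zero ?_ (hmem i _) (hmem j _)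
    exact (hind.indepFun hj.symm).comp (φ := fun z => inner ℝ (x i) z)
      (ψ := fun z => inner ℝ (y j) z) (by fun_prop) (by fun_prop)
  · simp

end PiGaussian

/-- The Gram matrix `XᵀX` of a design with rows `X k`. -/
abbrev designGram {n p : ℕ} (X : Fin n → EuclideanSpace ℝ (Fin p)) :
    Matrix (Fin p) (Fin p) ℝ :=
  (Matrix.of fun k => (X k).ofLp)ᵀ * Matrix.of fun k => (X k).ofLp

lemma designGram_posSemidef {n p : ℕ} (X : Fin n → EuclideanSpace ℝ (Fin p)) :
    (designGram X).PosSemidef := by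
  simpa using posSemidef_conjTranspose_mul_self (Matrix.of fun k => (X k).ofLp)

/-! ### Local minimax lower bound for a fixed design. -/

namespace Views

variable {m d : ℕ} (V : Views m d) {S : Matrix (Fin d) (Fin d) ℝ} {σ : ℝ}

/-- Local minimax bound for a fixed design, along the line `θ + (t/√n) w`. -/
lemma le_minimaxRisk (hS : S.PosDef) (hσ : 0 < σ) (θ : EuclideanSpace ℝ (Fin d)) {n s : ℕ}
    (hn : 0 < n) (X : (i : Fin m) → Fin n → EuclideanSpace ℝ (Fin (V.obs i)))
    (hX : ∀ i, IsUnit (designGram (X i))) {c : ℝ} {v : Fin m → ℝ} {r : ℝ} (hr : 0 < r)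
    (hv : ∀ i, 0 < v i)
    (hball : ∀ ϑ, ‖ϑ - θ‖ ≤ c / √(n : ℝ) → ∀ i,
      v i ≤ V.labelVar S σ ϑ i ∧ V.labelVar S σ ϑ i ≤ r ^ 2 * v i)
    {ψ : EuclideanSpace ℝ (Fin d) → EuclideanSpace ℝ (Fin s)} {u : EuclideanSpace ℝ (Fin s)}
    {u' : EuclideanSpace ℝ (Fin d)} (hψ : ∀ ϑ, inner ℝ u (ψ ϑ) = inner ℝ u' ϑ)
    (w : EuclideanSpace ℝ (Fin d)) {M : ℝ} (hM : 0 ≤ M) (hMc : M * ‖w‖ ≤ c) {I : ℝ}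
    (hI : I = ∑ i, (v i)⁻¹ * ((euclMul (V.transfer S i) w).ofLp ⬝ᵥ
      ((n : ℝ)⁻¹ • designGram (X i)) *ᵥ (euclMul (V.transfer S i) w).ofLp))
    (hI0 : 0 < I) {τ : NNReal} (hτ : 0 < τ) :
    (∏ i, (ENNReal.ofReal r⁻¹) ^ V.obs i) *
      (ENNReal.ofReal ((inner ℝ u' w) ^ 2 * (τ * I⁻¹ / (τ + I⁻¹))) -
        ∫⁻ t in {t | M < |t|}, ENNReal.ofReal (4 * (inner ℝ u' w) ^ 2 * t ^ 2) ∂(gaussianReal 0 τ))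
      ≤ V.minimaxRisk S σ θ X ψ c u := by
  set κ : ℝ≥0∞ := ∏ i, (ENNReal.ofReal r⁻¹) ^ V.obs i with hκ
  have hκ0 : κ ≠ 0 := Finset.prod_ne_zero_iff.2 fun i _ =>
    pow_ne_zero _ (ENNReal.ofReal_pos.2 (inv_pos.2 hr)).ne'
  have hκt : κ ≠ ∞ := ENNReal.prod_ne_top fun i _ => ENNReal.pow_ne_top ENNReal.ofReal_ne_top
  have hnR : (0 : ℝ) < n := by exact_mod_cast hn
  have hsn : 0 < √(n : ℝ) := Real.sqrt_pos.2 hnR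
  refine le_iInf₂ fun est hest => ?_
  set R := ⨆ (ϑ : EuclideanSpace ℝ (Fin d)) (_ : ‖ϑ - θ‖ ≤ c / √(n : ℝ)),
      ∫⁻ z, ENNReal.ofReal (n * inner ℝ u (est z - ψ ϑ) ^ 2) ∂(V.olsLaw S σ X ϑ) with hR
  set a := inner ℝ u' w with ha
  set K : (i : Fin m) → Matrix (Fin (V.obs i)) (Fin (V.obs i)) ℝ := fun i =>
    v i • (designGram (X i))⁻¹ with hK
  have hKpsd : ∀ i, (K i).PosSemidef := fun i =>
    (designGram_posSemidef (X i)).inv.smul (hv i).le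
  set ν := Measure.pi fun i => multivariateGaussian 0 (K i) with hν
  set b : (i : Fin m) → EuclideanSpace ℝ (Fin (V.obs i)) := fun i =>
    (√(n : ℝ))⁻¹ • euclMul (V.transfer S i) w with hb
  -- Chosen so that `K i y i = I⁻¹ b i`. Then `ℓ` is the weighted least squares estimator of `t`,
  -- normalized by `ℓ b = 1`, and its variance is the inverse information `I⁻¹`.
  set y : (i : Fin m) → EuclideanSpace ℝ (Fin (V.obs i)) := fun i =>
    (I⁻¹ * (v i)⁻¹) • euclMul (designGram (X i)) (b i) with hy
  set ℓ : StrongDual ℝ ((i : Fin m) → EuclideanSpace ℝ (Fin (V.obs i))) :=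
    ∑ i, (innerSL ℝ (y i)).comp (ContinuousLinearMap.proj i) with hℓ
  have hℓa : ∀ z, ℓ z = ∑ i, inner ℝ (y i) (z i) := fun z => by
    simp [hℓ]
  have hKy : ∀ i, euclMul (K i) (y i) = I⁻¹ • b i := by
    intro i
    have hdet : IsUnit (designGram (X i)).det := (Matrix.isUnit_iff_isUnit_det _).1 (hX i)
    have h1 : K i * designGram (X i) = v i • (1 : Matrix _ _ ℝ) := by
      rw [hK, Matrix.smul_mul, nonsing_inv_mul _ hdet]
    rw [hy, euclMul_smul, euclMul_euclMul, h1]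
    have h2 : euclMul (v i • (1 : Matrix (Fin (V.obs i)) (Fin (V.obs i)) ℝ)) (b i) = v i • b i := by
      ext k; simp [euclMul, smul_mulVec]
    rw [h2, smul_smul, mul_assoc, inv_mul_cancel₀ (hv i).ne', mul_one]
  have hcov : ∀ L : StrongDual ℝ ((i : Fin m) → EuclideanSpace ℝ (Fin (V.obs i))),
      cov[L, ℓ; ν] = I⁻¹ * L b := by
    intro L
    have h1 : (ℓ : ((i : Fin m) → EuclideanSpace ℝ (Fin (V.obs i))) → ℝ)
        = fun z => ∑ i, inner ℝ (y i) (z i) := funext hℓa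
    rw [h1, covariance_pi_multivariateGaussian hKpsd y L]
    simp_rw [hKy]
    have h2 : (fun i => I⁻¹ • b i) = I⁻¹ • b := rfl
    rw [h2, map_smul, smul_eq_mul]
  have hℓb : ℓ b = 1 := by
    rw [hℓa]
    have h1 : ∀ i, inner ℝ (y i) (b i) = I⁻¹ * ((v i)⁻¹ * ((euclMul (V.transfer S i) w).ofLp ⬝ᵥ
      ((n : ℝ)⁻¹ • designGram (X i)) *ᵥ (euclMul (V.transfer S i) w).ofLp)) := by
      intro i
      rw [hy, real_inner_smul_left, real_inner_comm, real_inner_eq_dotProduct, euclMul_apply, hb]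
      simp only [WithLp.ofLp_smul, mulVec_smul, smul_dotProduct, dotProduct_smul, smul_eq_mul,
        smul_mulVec]
      have h2 : (√(n : ℝ))⁻¹ * (√(n : ℝ))⁻¹ = (n : ℝ)⁻¹ := by
        rw [← mul_inv, Real.mul_self_sqrt hnR.le]
      rw [← h2]
      ring
    rw [Finset.sum_congr rfl fun i _ => h1 i, ← Finset.mul_sum, ← hI, inv_mul_cancel₀ hI0.ne']
  set z0 : (i : Fin m) → EuclideanSpace ℝ (Fin (V.obs i)) := fun i => euclMul (V.transfer S i) θ
    with hz0
  -- Recentred at `θ` and rescaled by `√n`, so that `(δ - a t)²` is the normalized loss of `est` at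
  -- `θ + (t/√n) w`.
  set δ : ((i : Fin m) → EuclideanSpace ℝ (Fin (V.obs i))) → ℝ := fun z =>
    √(n : ℝ) * (inner ℝ u (est (z0 + z)) - inner ℝ u' θ) with hδ
  have hδm : Measurable δ := by
    have : Measurable fun z => est (z0 + z) := hest.comp (measurable_const_add z0)
    simp only [hδ]
    fun_prop
  have hrisk : ∀ t : ℝ, |t| ≤ M →
      ∫⁻ g, ENNReal.ofReal ((δ (t • b + g) - a * t) ^ 2) ∂ν ≤ κ⁻¹ * R := by
    intro t ht
    set ϑ := θ + (t * (√(n : ℝ))⁻¹) • w with hϑ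
    have hmem : ‖ϑ - θ‖ ≤ c / √(n : ℝ) := by
      rw [hϑ, add_sub_cancel_left, norm_smul, Real.norm_eq_abs, abs_mul, abs_of_pos (inv_pos.2 hsn),
        div_eq_mul_inv, mul_right_comm]
      gcongr
      exact (mul_le_mul_of_nonneg_right ht (norm_nonneg w)).trans hMc
    have hle := V.le_olsLaw hS hσ X ϑ hX hr hv (fun i => (hball ϑ hmem i).1)
      (fun i => (hball ϑ hmem i).2)
    have hfm : Measurable fun z => ENNReal.ofReal (n * inner ℝ u (est z - ψ ϑ) ^ 2) := by
      fun_prop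
    have h1 : κ * ∫⁻ g, ENNReal.ofReal ((δ (t • b + g) - a * t) ^ 2) ∂ν
        ≤ ∫⁻ z, ENNReal.ofReal (n * inner ℝ u (est z - ψ ϑ) ^ 2) ∂(V.olsLaw S σ X ϑ) := by
      refine le_trans (le_of_eq ?_) (lintegral_mono' hle le_rfl)
      rw [lintegral_smul_measure, lintegral_map hfm (by fun_prop), smul_eq_mul]
      congr 1
      refine lintegral_congr fun g => ?_
      congr 1
      have h2 : (fun i => euclMul (V.transfer S i) ϑ + g i) = z0 + (t • b + g) := by
        ext1 i
        simp only [hϑ, hz0, hb, euclMul_add, euclMul_smul, Pi.add_apply, Pi.smul_apply, smul_smul]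
        abel
      rw [h2, hδ, inner_sub_right, hψ, hϑ, inner_add_right, real_inner_smul_right, ← ha]
      have h3 : (n : ℝ) = √(n : ℝ) ^ 2 := (Real.sq_sqrt hnR.le).symm
      rw [h3, Real.sqrt_sq hsn.le, ← mul_pow]
      congr 1
      field_simp
      ring
    have h2 : ∫⁻ z, ENNReal.ofReal (n * inner ℝ u (est z - ψ ϑ) ^ 2) ∂(V.olsLaw S σ X ϑ) ≤ R :=
      le_iSup₂ (f := fun (ϑ : EuclideanSpace ℝ (Fin d)) (_ : ‖ϑ - θ‖ ≤ c / √(n : ℝ)) =>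
        ∫⁻ z, ENNReal.ofReal (n * inner ℝ u (est z - ψ ϑ) ^ 2) ∂(V.olsLaw S σ X ϑ)) ϑ hmem
    rw [← ENNReal.div_eq_inv_mul, ENNReal.le_div_iff_mul_le (Or.inl hκ0) (Or.inl hκt), mul_comm]
    exact h1.trans h2
  have hfinal := gaussianShift_minimax_ge ν hℓb (inv_pos.2 hI0) hcov hτ hδm a hM hrisk
  calc κ * _ ≤ κ * (κ⁻¹ * R) := by
        gcongr
        exact tsub_le_iff_right.2 hfinal
    _ = R := by rw [← mul_assoc, ENNReal.mul_inv_cancel hκ0 hκt, one_mul]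

end Views

/-! ### Asymptotic lower bound and convergence of the Gram matrices. -/

namespace Views

variable {m d : ℕ} (V : Views m d) {S : Matrix (Fin d) (Fin d) ℝ} {σ : ℝ}

lemma dotProduct_precision_mulVec (θ w : EuclideanSpace ℝ (Fin d)) :
    w.ofLp ⬝ᵥ V.precision S σ θ *ᵥ w.ofLp = ∑ i, (V.labelVar S σ θ i)⁻¹ *
      ((euclMul (V.transfer S i) w).ofLp ⬝ᵥ V.blockPP i S *ᵥ (euclMul (V.transfer S i) w).ofLp) := by
  rw [precision, sum_mulVec, dotProduct_sum]
  refine Finset.sum_congr rfl fun i _ => ?_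
  have h : V.gaussWeight S σ θ i = (V.labelVar S σ θ i)⁻¹ • V.blockPP i S := rfl
  rw [h, ← mulVec_mulVec, ← mulVec_mulVec, dotProduct_mulVec _ (V.transfer S i)ᵀ, vecMul_transpose,
    smul_mulVec, dotProduct_smul, smul_eq_mul]
  rfl

lemma precision_posSemidef (hS : S.PosDef) (hσ : 0 < σ) (θ : EuclideanSpace ℝ (Fin d)) :
    (V.precision S σ θ).PosSemidef := by
  refine Matrix.posSemidef_sum _ fun i _ => ?_
  have h : (V.gaussWeight S σ θ i).PosSemidef :=
    (V.blockPP_posDef hS i).posSemidef.smul (inv_pos.2 (V.labelVar_pos hS hσ θ i)).le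
  simpa using h.conjTranspose_mul_mul_same (V.transfer S i)

lemma covG_posSemidef (hS : S.PosDef) (hσ : 0 < σ) (θ : EuclideanSpace ℝ (Fin d)) :
    (V.covG S σ θ).PosSemidef :=
  (V.precision_posSemidef hS hσ θ).inv

lemma precision_mul_covG {θ : EuclideanSpace ℝ (Fin d)} (hC : IsUnit (V.precision S σ θ)) :
    V.precision S σ θ * V.covG S σ θ = 1 :=
  mul_nonsing_inv _ ((Matrix.isUnit_iff_isUnit_det _).1 hC)

/-- Local asymptotic minimax bound, for designs whose normalized Gram matrices converge. -/
lemma ofReal_le_liminf_minimaxRisk (hS : S.PosDef) (hσ : 0 < σ) (θ : EuclideanSpace ℝ (Fin d))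
    (hC : IsUnit (V.precision S σ θ))
    (X : (n : ℕ) → (i : Fin m) → Fin n → EuclideanSpace ℝ (Fin (V.obs i)))
    (hX : ∀ i, Tendsto (fun n : ℕ => (n : ℝ)⁻¹ • designGram (X n i)) atTop (nhds (V.blockPP i S)))
    {s : ℕ} {ψ : EuclideanSpace ℝ (Fin d) → EuclideanSpace ℝ (Fin s)} {u : EuclideanSpace ℝ (Fin s)}
    {u' : EuclideanSpace ℝ (Fin d)} (hψ : ∀ ϑ, inner ℝ u (ψ ϑ) = inner ℝ u' ϑ) :
    ENNReal.ofReal (u'.ofLp ⬝ᵥ V.covG S σ θ *ᵥ u'.ofLp) ≤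
      liminf (fun c : ℝ => liminf (fun n : ℕ =>
        V.minimaxRisk S σ θ (X n) ψ c u) atTop) atTop := by
  set q := u'.ofLp ⬝ᵥ V.covG S σ θ *ᵥ u'.ofLp with hq
  rcases le_or_gt q 0 with hq0 | hq0
  · rw [ENNReal.ofReal_of_nonpos hq0]; exact zero_le
  -- The least favourable direction: by Cauchy–Schwarz it maximizes `⟨u', w⟩² / (wᵀ (C^g)⁻¹ w)`, and
  -- the maximum is `q`.
  set w := euclMul (V.covG S σ θ) u' with hw
  have ha : inner ℝ u' w = q := by rw [real_inner_eq_dotProduct, hw, euclMul_apply]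
  have hwq : w.ofLp ⬝ᵥ V.precision S σ θ *ᵥ w.ofLp = q := by
    have : V.precision S σ θ *ᵥ w.ofLp = u'.ofLp := by
      rw [hw, euclMul_apply, mulVec_mulVec, V.precision_mul_covG hC, one_mulVec]
    rw [this, dotProduct_comm, ← ha, real_inner_eq_dotProduct]
  have hunit : ∀ᶠ n : ℕ in atTop, ∀ i, IsUnit (designGram (X n i)) := by
    refine eventually_all.2 fun i => ?_
    have hdet : Tendsto (fun n : ℕ => ((n : ℝ)⁻¹ • designGram (X n i)).det) atTop
        (nhds (V.blockPP i S).det) := ((continuous_id.matrix_det).tendsto _).comp (hX i)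
    filter_upwards [hdet.eventually_ne (V.blockPP_posDef hS i).det_pos.ne'] with n hn
    rw [Matrix.isUnit_iff_isUnit_det, isUnit_iff_ne_zero]
    intro h0
    rw [det_smul, h0, mul_zero] at hn
    exact hn rfl
  -- The parameter `ε` governs both the slack in the variances and the precision of the prior. It is
  -- fixed while `n → ∞` and then `c → ∞`, and tends to zero last.
  have key : ∀ ε : ℝ, 0 < ε →
      (∏ i, (ENNReal.ofReal (1 + ε)⁻¹) ^ V.obs i) *
        ENNReal.ofReal (q ^ 2 * ((1 + ε) * q + ε)⁻¹) ≤
      liminf (fun c : ℝ => liminf (fun n : ℕ =>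
        V.minimaxRisk S σ θ (X n) ψ c u) atTop) atTop := by
    intro ε hε
    set κ : ℝ≥0∞ := ∏ i, (ENNReal.ofReal (1 + ε)⁻¹) ^ V.obs i with hκ
    have hκt : κ ≠ ∞ := ENNReal.prod_ne_top fun i _ => ENNReal.pow_ne_top ENNReal.ofReal_ne_top
    -- With this prior variance, `τ I⁻¹ / (τ + I⁻¹) = (I + ε)⁻¹`; the prior flattens as `ε → 0`.
    set τ : NNReal := ⟨ε⁻¹, (inv_pos.2 hε).le⟩ with hτdef
    have hτ : 0 < τ := NNReal.coe_pos.1 (inv_pos.2 hε)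
    -- The variance at `θ` then lies strictly between `v i` and `(1 + ε) ^ 2 * v i`, so by
    -- continuity both bounds persist on the shrinking balls.
    set v : Fin m → ℝ := fun i => V.labelVar S σ θ i / (1 + ε) with hv
    have hv0 : ∀ i, 0 < v i := fun i => div_pos (V.labelVar_pos hS hσ θ i) (by positivity)
    set tail : ℝ → ℝ≥0∞ := fun M =>
      ∫⁻ t in {t | M < |t|}, ENNReal.ofReal (4 * q ^ 2 * t ^ 2) ∂(gaussianReal 0 τ) with htail
    set I : ℕ → ℝ := fun n => ∑ i, (v i)⁻¹ * ((euclMul (V.transfer S i) w).ofLp ⬝ᵥ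
      ((n : ℝ)⁻¹ • designGram (X n i)) *ᵥ (euclMul (V.transfer S i) w).ofLp) with hI
    have hIlim : Tendsto I atTop (nhds ((1 + ε) * q)) := by
      have h1 : (1 + ε) * q = ∑ i, (v i)⁻¹ * ((euclMul (V.transfer S i) w).ofLp ⬝ᵥ
          V.blockPP i S *ᵥ (euclMul (V.transfer S i) w).ofLp) := by
        rw [← hwq, dotProduct_precision_mulVec, Finset.mul_sum]
        refine Finset.sum_congr rfl fun i _ => ?_
        rw [hv, inv_div, div_eq_mul_inv, mul_assoc]
      rw [h1]
      refine tendsto_finsetSum _ fun i _ => Tendsto.const_mul _ ?_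
      have hcont : Continuous fun A : Matrix (Fin (V.obs i)) (Fin (V.obs i)) ℝ =>
          (euclMul (V.transfer S i) w).ofLp ⬝ᵥ A *ᵥ (euclMul (V.transfer S i) w).ofLp := by
        fun_prop
      exact (hcont.tendsto _).comp (hX i)
    have hJ : 0 < (1 + ε) * q := by positivity
    -- The range `M = c / (‖w‖ + 1)` keeps the segment inside the ball and still tends to infinity
    -- with `c`; the added 1 makes the denominator positive without separate treatment of `w`.
    have hn : ∀ c : ℝ, 0 ≤ c →
        κ * (ENNReal.ofReal (q ^ 2 * ((1 + ε) * q + ε)⁻¹) - tail (c / (‖w‖ + 1))) ≤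
        liminf (fun n : ℕ => V.minimaxRisk S σ θ (X n) ψ c u) atTop := by
      intro c hc
      have hball : ∀ᶠ n : ℕ in atTop, ∀ ϑ, ‖ϑ - θ‖ ≤ c / √(n : ℝ) → ∀ i,
          v i ≤ V.labelVar S σ ϑ i ∧ V.labelVar S σ ϑ i ≤ (1 + ε) ^ 2 * v i := by
        have hev : ∀ᶠ ϑ in nhds θ, ∀ i,
            v i ≤ V.labelVar S σ ϑ i ∧ V.labelVar S σ ϑ i ≤ (1 + ε) ^ 2 * v i := by
          refine eventually_all.2 fun i => ?_
          have hpos := V.labelVar_pos hS hσ θ i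
          have hlt : v i < V.labelVar S σ θ i := by
            rw [hv, div_lt_iff₀ (by positivity)]; nlinarith
          have hgt : V.labelVar S σ θ i < (1 + ε) ^ 2 * v i := by
            have : (1 + ε) ^ 2 * v i = (1 + ε) * V.labelVar S σ θ i := by
              rw [hv]; field_simp
            rw [this]; nlinarith
          have hct := (V.continuous_labelVar (S := S) (σ := σ) i).tendsto θ
          filter_upwards [hct.eventually_const_lt hlt, hct.eventually_lt_const hgt] with ϑ h1 h2
            using ⟨h1.le, h2.le⟩
        obtain ⟨ρ, hρ, hρ'⟩ := Metric.eventually_nhds_iff.1 hev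
        have hlim : Tendsto (fun n : ℕ => c / √(n : ℝ)) atTop (nhds 0) :=
          tendsto_const_nhds.div_atTop
            (Real.tendsto_sqrt_atTop.comp tendsto_natCast_atTop_atTop)
        filter_upwards [hlim.eventually_lt_const hρ] with n hn ϑ hϑ
        exact hρ' (by rw [dist_eq_norm]; exact hϑ.trans_lt hn)
      have hlimF : Tendsto (fun n => κ * (ENNReal.ofReal (q ^ 2 * (τ * (I n)⁻¹ / (τ + (I n)⁻¹)))
          - tail (c / (‖w‖ + 1)))) atTop
          (nhds (κ * (ENNReal.ofReal (q ^ 2 * ((1 + ε) * q + ε)⁻¹) - tail (c / (‖w‖ + 1))))) := by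
        refine ENNReal.Tendsto.const_mul (ENNReal.Tendsto.sub ?_ tendsto_const_nhds
          (Or.inl ENNReal.ofReal_ne_top)) (Or.inr hκt)
        refine ENNReal.tendsto_ofReal (Tendsto.const_mul _ ?_)
        have h1 : ((1 + ε) * q + ε)⁻¹ = τ * ((1 + ε) * q)⁻¹ / (τ + ((1 + ε) * q)⁻¹) := by
          have : (τ : ℝ) = ε⁻¹ := rfl
          rw [this]
          field_simp
        rw [h1]
        have hinv := hIlim.inv₀ hJ.ne'
        refine (hinv.const_mul _).div (hinv.const_add _) ?_
        positivity
      rw [← hlimF.liminf_eq]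
      refine liminf_le_liminf ?_
      filter_upwards [hunit, hball, hIlim.eventually_const_lt hJ, eventually_gt_atTop 0]
        with n h1 h2 h3 h4
      have hMc : c / (‖w‖ + 1) * ‖w‖ ≤ c := by
        rw [div_mul_eq_mul_div, div_le_iff₀ (by positivity)]
        nlinarith
      have := V.le_minimaxRisk hS hσ θ h4 (X n) h1 (by positivity : 0 < 1 + ε) hv0 h2 hψ w
        (by positivity : 0 ≤ c / (‖w‖ + 1)) hMc (I := I n) rfl h3 hτ
      rwa [ha] at this
    have hlimc : Tendsto (fun c : ℝ => κ * (ENNReal.ofReal (q ^ 2 * ((1 + ε) * q + ε)⁻¹)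
        - tail (c / (‖w‖ + 1)))) atTop (nhds (κ * ENNReal.ofReal (q ^ 2 * ((1 + ε) * q + ε)⁻¹))) := by
      refine ENNReal.Tendsto.const_mul ?_ (Or.inr hκt)
      have h1 : Tendsto (fun c : ℝ => tail (c / (‖w‖ + 1))) atTop (nhds 0) :=
        (tendsto_setLIntegral_tail_gaussianReal τ (4 * q ^ 2)).comp
          (tendsto_id.atTop_div_const (by positivity))
      simpa using ENNReal.Tendsto.sub (tendsto_const_nhds
        (x := ENNReal.ofReal (q ^ 2 * ((1 + ε) * q + ε)⁻¹))) h1 (Or.inl ENNReal.ofReal_ne_top)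
    rw [← hlimc.liminf_eq]
    refine liminf_le_liminf ?_
    filter_upwards [eventually_ge_atTop 0] with c hc using hn c hc
  have hlim : Tendsto (fun ε : ℝ => (∏ i, (ENNReal.ofReal (1 + ε)⁻¹) ^ V.obs i) *
      ENNReal.ofReal (q ^ 2 * ((1 + ε) * q + ε)⁻¹)) (nhdsWithin 0 (Set.Ioi 0))
      (nhds (ENNReal.ofReal q)) := by
    have h0 : Tendsto (fun ε : ℝ => ε) (nhdsWithin 0 (Set.Ioi 0)) (nhds 0) :=
      tendsto_nhdsWithin_of_tendsto_nhds tendsto_id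
    have h1 : Tendsto (fun ε : ℝ => ENNReal.ofReal (1 + ε)⁻¹) (nhdsWithin 0 (Set.Ioi 0)) (nhds 1) := by
      have := ENNReal.tendsto_ofReal ((h0.const_add 1).inv₀ (by norm_num))
      simpa using this
    have h2 : Tendsto (fun ε : ℝ => ∏ i, (ENNReal.ofReal (1 + ε)⁻¹) ^ V.obs i)
        (nhdsWithin 0 (Set.Ioi 0)) (nhds 1) := by
      have := ENNReal.tendsto_finsetProd_of_ne_top (f := fun i (ε : ℝ) =>
        (ENNReal.ofReal (1 + ε)⁻¹) ^ V.obs i) (x := nhdsWithin 0 (Set.Ioi 0)) (a := fun _ => 1)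
        (Finset.univ : Finset (Fin m)) (fun i _ => by simpa using ENNReal.Tendsto.pow h1)
        (fun i _ => ENNReal.one_ne_top)
      simpa using this
    have h3 : Tendsto (fun ε : ℝ => ENNReal.ofReal (q ^ 2 * ((1 + ε) * q + ε)⁻¹))
        (nhdsWithin 0 (Set.Ioi 0)) (nhds (ENNReal.ofReal q)) := by
      refine ENNReal.tendsto_ofReal ?_
      have h4 := ((((h0.const_add 1).mul_const q).add h0).inv₀ (by simpa using hq0.ne')).const_mul
        (q ^ 2)
      convert h4 using 2
      field_simp
      ring
    have := ENNReal.Tendsto.mul h2 (Or.inl one_ne_zero) h3 (Or.inr ENNReal.one_ne_top)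
    simpa using this
  exact le_of_tendsto hlim (by
    filter_upwards [self_mem_nhdsWithin] with ε hε using key ε hε)

/-- The normalized Gram matrices of a Gaussian design converge almost surely. -/
lemma IsGaussianDesign.ae_tendsto_gram (hS : S.PosDef) {Ω : Type*} [MeasurableSpace Ω]
    {P : Measure Ω} [IsProbabilityMeasure P]
    {X : (n : ℕ) → (i : Fin m) → Fin n → Ω → EuclideanSpace ℝ (Fin (V.obs i))}
    (hX : V.IsGaussianDesign S X P) :
    ∀ᵐ ω ∂P, ∀ i, Tendsto (fun n : ℕ => (n : ℝ)⁻¹ • designGram (fun k => X n i k ω)) atTop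
      (nhds (V.blockPP i S)) := by
  refine ae_all_iff.2 fun i => ?_
  have hK := (V.blockPP_posDef hS i).posSemidef
  -- Eighth moments of the coordinates put their pairwise products in `L⁴`, as the law of large
  -- numbers demands.
  have h8 : ∀ a, MemLp (fun x : EuclideanSpace ℝ (Fin (V.obs i)) => x a) 8
      (multivariateGaussian 0 (V.blockPP i S)) := fun a =>
    IsGaussian.memLp_dual _ (EuclideanSpace.proj a) 8 (by simp)
  have hmean : ∀ a, ∫ x : EuclideanSpace ℝ (Fin (V.obs i)), x a
      ∂(multivariateGaussian 0 (V.blockPP i S)) = 0 := by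
    intro a
    have := (EuclideanSpace.proj (𝕜 := ℝ) a).integral_comp_id_comm
      (IsGaussian.integrable_id (μ := multivariateGaussian 0 (V.blockPP i S)))
    simpa using this
  have hab : ∀ a b, ∀ᵐ ω ∂P, Tendsto (fun n : ℕ => (n : ℝ)⁻¹ * ∑ k, X n i k ω a * X n i k ω b)
      atTop (nhds (V.blockPP i S a b)) := by
    intro a b
    have hL : MemLp (fun x : EuclideanSpace ℝ (Fin (V.obs i)) => x a * x b) 4
        (multivariateGaussian 0 (V.blockPP i S)) := by
      have : ENNReal.HolderTriple 8 8 4 := ⟨by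
        rw [← two_mul, show (8 : ℝ≥0∞) = 2 * 4 by norm_num,
          ENNReal.mul_inv (by simp) (by simp), ← mul_assoc,
          ENNReal.mul_inv_cancel (by simp) (by simp), one_mul]⟩
      exact (h8 b).mul' (h8 a)
    have hfint : ∫ x : EuclideanSpace ℝ (Fin (V.obs i)), x a * x b
        ∂(multivariateGaussian 0 (V.blockPP i S)) = V.blockPP i S a b := by
      have hcov := covariance_eval_multivariateGaussian (μ := 0) hK a b
      rw [covariance_eq_sub ((h8 a).mono_exponent (by norm_num))
        ((h8 b).mono_exponent (by norm_num)), hmean, zero_mul, sub_zero] at hcov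
      exact hcov
    have := ae_tendsto_rowMean (Z := fun n k => X n i k) (fun n k => hX.law n i k)
      (fun n => hX.indep n i) (f := fun x => x a * x b) (by fun_prop) hL
    rwa [hfint] at this
  filter_upwards [ae_all_iff.2 fun a => ae_all_iff.2 fun b => hab a b] with ω hω
  refine tendsto_pi_nhds.2 fun a => tendsto_pi_nhds.2 fun b => ?_
  simpa [designGram, Matrix.mul_apply] using hω a b

end Views

/-! ### Tools for asymptotic normality. -/

section Auxiliary

/-- The scalar central limit theorem in terms of characteristic functions, reduced to unit variance
by scaling. Only the law of `Y` enters, so it suits triangular arrays. -/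
lemma tendsto_charFun_pow_of_variance {Ω : Type*} [MeasurableSpace Ω] {P : Measure Ω}
    [IsProbabilityMeasure P] {Y : Ω → ℝ} (hY : MemLp Y 2 P) (h0 : ∫ ω, Y ω ∂P = 0) {q : ℝ}
    (hq : ∫ ω, Y ω ^ 2 ∂P = q) :
    Tendsto (fun n : ℕ => (charFun (P.map Y) ((√(n : ℝ))⁻¹)) ^ n) atTop
      (nhds (Complex.exp (-q / 2))) := by
  have hYm : AEMeasurable Y P := hY.aestronglyMeasurable.aemeasurable
  have hq0 : 0 ≤ q := hq ▸ integral_nonneg fun ω => sq_nonneg _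
  -- The degenerate case does occur: an agent contributes nothing in a direction `t` with `T_i t =
  -- 0`.
  rcases hq0.eq_or_lt with rfl | hpos
  · have hz : Y =ᵐ[P] fun _ => 0 := by
      have := (integral_eq_zero_iff_of_nonneg (fun ω => sq_nonneg (Y ω)) hY.integrable_sq).1 hq
      filter_upwards [this] with ω hω
      simpa using hω
    rw [Measure.map_congr hz]
    simp
  · set X : Ω → ℝ := fun ω => (√q)⁻¹ * Y ω with hX
    have hsq : √q ≠ 0 := (Real.sqrt_pos.2 hpos).ne'
    have h1 : ∫ ω, X ω ∂P = 0 := by rw [hX, integral_const_mul, h0, mul_zero]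
    have h2 : ∫ ω, (X ^ 2) ω ∂P = 1 := by
      simp only [hX, Pi.pow_apply, mul_pow]
      rw [integral_const_mul, hq, inv_pow, Real.sq_sqrt hq0, inv_mul_cancel₀ hpos.ne']
    have h := tendsto_charFun_inv_sqrt_mul_pow (X := X) (hYm.const_mul _) h1 h2 (√q)
    have h3 : ∀ n : ℕ, charFun (P.map X) ((√(n : ℝ))⁻¹ * √q) = charFun (P.map Y) ((√(n : ℝ))⁻¹) := by
      intro n
      rw [hX, charFun_map_mul_comp hYm]
      congr 1
      field_simp
    simp_rw [h3] at h
    convert h using 4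
    rw [← Complex.ofReal_pow, Real.sq_sqrt hq0]

/-- A quantity `o(1) * (1 + Q n)` with `Q n` bounded in mean is negligible in probability. Where `Q
n < L`, the ratio controls `D n` up to the factor `1 + L`; the complement is small by Markov's
inequality. -/
lemma tendstoInMeasure_zero_of_ae_tendsto_div {Ω E : Type*} [MeasurableSpace Ω] {P : Measure Ω}
    [IsProbabilityMeasure P] [NormedAddCommGroup E] [MeasurableSpace E] [BorelSpace E]
    {D : ℕ → Ω → E} (hD : ∀ n, AEMeasurable (D n) P) {Q : ℕ → Ω → ℝ}
    (hQ0 : ∀ n ω, 0 ≤ Q n ω) (hQ : ∀ n, Integrable (Q n) P) {K : ℝ}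
    (hK : ∀ n, ∫ ω, Q n ω ∂P ≤ K)
    (hlim : ∀ᵐ ω ∂P, Tendsto (fun n => ‖D n ω‖ / (1 + Q n ω)) atTop (nhds 0)) :
    TendstoInMeasure P D atTop 0 := by
  have hA : TendstoInMeasure P (fun n ω => ‖D n ω‖ / (1 + Q n ω)) atTop (fun _ => (0 : ℝ)) := by
    refine tendstoInMeasure_of_tendsto_ae (fun n => ?_) hlim
    exact ((hD n).norm.div ((hQ n).aemeasurable.const_add 1)).aestronglyMeasurable
  rw [tendstoInMeasure_iff_norm] at hA ⊢
  intro ε hε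
  rw [ENNReal.tendsto_nhds_zero]
  intro η hη
  rcases eq_or_ne η ∞ with rfl | hηt
  · simp
  have hK0 : 0 ≤ K := (integral_nonneg (hQ0 0)).trans (hK 0)
  have hηR : 0 < η.toReal := ENNReal.toReal_pos hη.ne' hηt
  -- Markov's inequality then gives `K / L ≤ η / 2`; the added 1 keeps `L` positive when `K = 0`.
  set L : ℝ := 2 * (K + 1) / η.toReal with hL
  have hL0 : 0 < L := by positivity
  have hmarkov : ∀ n, P {ω | L ≤ Q n ω} ≤ η / 2 := by
    intro n
    have h1 := (mul_meas_ge_le_integral_of_nonneg (Eventually.of_forall (hQ0 n)) (hQ n) L).trans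
      (hK n)
    have h2 : P.real {ω | L ≤ Q n ω} ≤ η.toReal / 2 := by
      rw [mul_comm, ← le_div_iff₀ hL0] at h1
      refine h1.trans ?_
      rw [hL, div_div_eq_mul_div, div_le_iff₀ (by positivity)]
      nlinarith
    calc P {ω | L ≤ Q n ω} = ENNReal.ofReal (P.real {ω | L ≤ Q n ω}) := by rw [ofReal_measureReal]
      _ ≤ ENNReal.ofReal (η.toReal / 2) := ENNReal.ofReal_le_ofReal h2
      _ = η / 2 := by
        rw [ENNReal.ofReal_div_of_pos two_pos, ENNReal.ofReal_toReal hηt]; simp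
  have hev := (ENNReal.tendsto_nhds_zero.1 (hA (ε / (1 + L)) (by positivity))) (η / 2)
    (ENNReal.half_pos hη.ne')
  filter_upwards [hev] with n hn
  have hsub : {ω | ε ≤ ‖D n ω - (0 : Ω → E) ω‖} ⊆ {ω | L ≤ Q n ω} ∪
      {ω | ε / (1 + L) ≤ ‖‖D n ω‖ / (1 + Q n ω) - 0‖} := by
    intro ω hω
    have hω' : ε ≤ ‖D n ω‖ := by simpa using hω
    by_cases hQL : L ≤ Q n ω
    · exact Or.inl hQL
    · refine Or.inr ?_
      have h0 := hQ0 n ω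
      show ε / (1 + L) ≤ ‖‖D n ω‖ / (1 + Q n ω) - 0‖
      rw [sub_zero, Real.norm_eq_abs, abs_of_nonneg (by positivity)]
      exact div_le_div₀ (norm_nonneg _) hω' (by positivity) (by linarith [not_le.1 hQL])
  calc P {ω | ε ≤ ‖D n ω - (0 : Ω → E) ω‖} ≤ _ := measure_mono hsub
    _ ≤ _ := measure_union_le _ _
    _ ≤ η / 2 + η / 2 := add_le_add (hmarkov n) hn
    _ = η := ENNReal.add_halves η

lemma norm_le_sum_abs {p : ℕ} (v : EuclideanSpace ℝ (Fin p)) : ‖v‖ ≤ ∑ a, |v a| := by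
  have h : v = ∑ a, v a • EuclideanSpace.basisFun (Fin p) ℝ a := by
    conv_lhs => rw [← (EuclideanSpace.basisFun (Fin p) ℝ).sum_repr v]
    simp
  calc ‖v‖ = ‖∑ a, v a • EuclideanSpace.basisFun (Fin p) ℝ a‖ := by rw [← h]
    _ ≤ ∑ a, ‖v a • EuclideanSpace.basisFun (Fin p) ℝ a‖ := norm_sum_le _ _
    _ = ∑ a, |v a| := by simp [norm_smul]

lemma norm_euclMul_le {p q : ℕ} (A : Matrix (Fin p) (Fin q) ℝ) (v : EuclideanSpace ℝ (Fin q)) :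
    ‖euclMul A v‖ ≤ (∑ a, ∑ b, |A a b|) * ∑ b, |v b| := by
  refine (norm_le_sum_abs _).trans ?_
  rw [Finset.sum_mul]
  refine Finset.sum_le_sum fun a _ => ?_
  have h : (euclMul A v) a = ∑ b, A a b * v b := rfl
  rw [h, Finset.sum_mul]
  refine (Finset.abs_sum_le_sum_abs _ _).trans (Finset.sum_le_sum fun b _ => ?_)
  rw [abs_mul]
  exact mul_le_mul_of_nonneg_left
    (Finset.single_le_sum (f := fun b => |v b|) (fun _ _ => abs_nonneg _) (Finset.mem_univ b))
    (abs_nonneg _)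

/-- First-order condition at a minimum: the step `t = -b / (|q| + 1)` is short enough for the linear
term to outweigh the quadratic one. -/
lemma eq_zero_of_forall_quadratic_nonneg {b q : ℝ} (h : ∀ t : ℝ, 0 ≤ 2 * t * b + t ^ 2 * q) :
    b = 0 := by
  by_contra hb
  have hb2 : 0 < b ^ 2 := by positivity
  have hq : 0 < |q| + 1 := by positivity
  have h1 := h (-b / (|q| + 1))
  have h2 : 2 * (-b / (|q| + 1)) * b + (-b / (|q| + 1)) ^ 2 * q
      = b ^ 2 * (q - 2 * (|q| + 1)) / (|q| + 1) ^ 2 := by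
    field_simp
    ring
  rw [h2] at h1
  have h3 : b ^ 2 * (q - 2 * (|q| + 1)) / (|q| + 1) ^ 2 < 0 := by
    refine div_neg_of_neg_of_pos (mul_neg_of_pos_of_neg hb2 ?_) (by positivity)
    linarith [le_abs_self q, abs_nonneg q]
  linarith

lemma tendsto_matrix_inv {p : ℕ} {A : ℕ → Matrix (Fin p) (Fin p) ℝ} {B : Matrix (Fin p) (Fin p) ℝ}
    (h : Tendsto A atTop (nhds B)) (hB : IsUnit B) :
    Tendsto (fun n => (A n)⁻¹) atTop (nhds B⁻¹) := by
  have hdet : B.det ≠ 0 := ((Matrix.isUnit_iff_isUnit_det _).1 hB).ne_zero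
  refine (continuousAt_matrix_inv B ?_).tendsto.comp h
  rw [Ring.inverse_eq_inv']
  exact continuousAt_inv₀ hdet

lemma eventually_isUnit_of_tendsto {p : ℕ} {A : ℕ → Matrix (Fin p) (Fin p) ℝ}
    {B : Matrix (Fin p) (Fin p) ℝ} (h : Tendsto A atTop (nhds B)) (hB : IsUnit B) :
    ∀ᶠ n in atTop, IsUnit (A n) := by
  have hdet : Tendsto (fun n => (A n).det) atTop (nhds B.det) :=
    ((continuous_id.matrix_det).tendsto _).comp h
  filter_upwards [hdet.eventually_ne ((Matrix.isUnit_iff_isUnit_det _).1 hB).ne_zero] with n hn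
  rw [Matrix.isUnit_iff_isUnit_det, isUnit_iff_ne_zero]
  exact hn

end Auxiliary

/-! ### The effective noise: its orthogonality to the observed features. -/

namespace Views

variable {m d : ℕ} (V : Views m d) {S : Matrix (Fin d) (Fin d) ℝ} {σ : ℝ}

/-- The coefficients of the part of `⟨x, θ⟩` that the observed features do not predict. -/
noncomputable def residualCoeff (S : Matrix (Fin d) (Fin d) ℝ) (θ : EuclideanSpace ℝ (Fin d))
    (i : Fin m) : EuclideanSpace ℝ (Fin d) :=
  WithLp.toLp 2 fun j => Sum.elim
    (fun a => (-euclMul ((V.blockPP i S)⁻¹ * V.blockPM i S) (V.minus i θ)) a)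
    (fun a => V.minus i θ a) ((V.view i).symm j)

/-- The effective noise `y - ⟨x_{i+}, T_i θ⟩` of agent `i` in a sample `(x, ξ)`. -/
noncomputable def effNoise (S : Matrix (Fin d) (Fin d) ℝ) (θ : EuclideanSpace ℝ (Fin d))
    (i : Fin m) : EuclideanSpace ℝ (Fin d) × ℝ →L[ℝ] ℝ :=
  (innerSL ℝ (V.residualCoeff S θ i)).comp (ContinuousLinearMap.fst ℝ _ _)
    + ContinuousLinearMap.snd ℝ _ _

lemma dotProduct_view (i : Fin m) (x y : Fin d → ℝ) :
    x ⬝ᵥ y = ∑ a, x (V.view i (Sum.inl a)) * y (V.view i (Sum.inl a))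
      + ∑ a, x (V.view i (Sum.inr a)) * y (V.view i (Sum.inr a)) := by
  rw [dotProduct, ← (V.view i).sum_comp, Fintype.sum_sum_type]

/-- The population regression of the label on the observed features: it turns each agent's data into
a linear model with parameter `T_i θ`. -/
lemma label_eq (θ : EuclideanSpace ℝ (Fin d)) (i : Fin m) (z : EuclideanSpace ℝ (Fin d) × ℝ) :
    inner ℝ z.1 θ + z.2
      = inner ℝ (V.plus i z.1) (euclMul (V.transfer S i) θ) + V.effNoise S θ i z := by
  have h : V.effNoise S θ i z = inner ℝ (V.residualCoeff S θ i) z.1 + z.2 := by simp [effNoise]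
  rw [h, V.euclMul_transfer, ← add_assoc, add_left_inj, inner_add_right]
  simp only [real_inner_eq_dotProduct]
  rw [V.dotProduct_view i, V.dotProduct_view i (V.residualCoeff S θ i).ofLp]
  simp only [residualCoeff, Equiv.symm_apply_apply, Sum.elim_inl, Sum.elim_inr, dotProduct, plus,
    minus, PiLp.neg_apply]
  rw [add_assoc, ← add_assoc (∑ a, z.1.ofLp (V.view i (Sum.inl a)) * _) (∑ a, -_ * _),
    ← Finset.sum_add_distrib]
  simp [mul_comm]

/-- The zeros on the observed coordinates say that the effective noise is uncorrelated with
`x_{i+}`; the missing coordinates produce its variance through the Schur complement. -/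
lemma mulVec_residualCoeff (hS : S.PosDef) (θ : EuclideanSpace ℝ (Fin d)) (i : Fin m)
    (s : Fin (V.obs i) ⊕ Fin (V.hid i)) :
    (S *ᵥ (V.residualCoeff S θ i).ofLp) (V.view i s)
      = Sum.elim (fun _ => 0) (V.schur S i *ᵥ (V.minus i θ).ofLp) s := by
  have hdet : IsUnit (V.blockPP i S).det :=
    (Matrix.isUnit_iff_isUnit_det _).1 (V.blockPP_posDef hS i).isUnit
  have hP : (fun a => (V.residualCoeff S θ i) (V.view i (Sum.inl a)))
      = -(((V.blockPP i S)⁻¹ * V.blockPM i S) *ᵥ (V.minus i θ).ofLp) := by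
    ext a; simp [residualCoeff, euclMul]
  have hM : (fun a => (V.residualCoeff S θ i) (V.view i (Sum.inr a))) = (V.minus i θ).ofLp := by
    ext a; simp [residualCoeff]
  rw [mulVec, V.dotProduct_view i]
  rcases s with a | a
  · have h1 : (V.blockPP i S *ᵥ (fun a => (V.residualCoeff S θ i) (V.view i (Sum.inl a)))) a
        + (V.blockPM i S *ᵥ (fun a => (V.residualCoeff S θ i) (V.view i (Sum.inr a)))) a = 0 := by
      rw [hP, hM, mulVec_neg, mulVec_mulVec, ← Matrix.mul_assoc, mul_nonsing_inv _ hdet,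
        Matrix.one_mul]
      simp
    exact h1
  · have h1 : (V.blockMP i S *ᵥ (fun a => (V.residualCoeff S θ i) (V.view i (Sum.inl a)))) a
        + (V.blockMM i S *ᵥ (fun a => (V.residualCoeff S θ i) (V.view i (Sum.inr a)))) a
        = (V.schur S i *ᵥ (V.minus i θ).ofLp) a := by
      rw [hP, hM, mulVec_neg, mulVec_mulVec, ← Matrix.mul_assoc, schur, sub_mulVec]
      simp only [Pi.neg_apply, Pi.sub_apply]
      ring
    exact h1

lemma residualCoeff_dotProduct (hS : S.PosDef) (θ : EuclideanSpace ℝ (Fin d)) (i : Fin m) :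
    (V.residualCoeff S θ i).ofLp ⬝ᵥ S *ᵥ (V.residualCoeff S θ i).ofLp
      = (V.minus i θ).ofLp ⬝ᵥ V.schur S i *ᵥ (V.minus i θ).ofLp := by
  rw [V.dotProduct_view i]
  simp only [V.mulVec_residualCoeff hS, Sum.elim_inl, Sum.elim_inr, mul_zero,
    Finset.sum_const_zero, zero_add]
  simp [residualCoeff, dotProduct]

end Views

/-- The law of one sample: features `N(0, Σ)` and independent noise `N(0, σ²)`. -/
noncomputable abbrev sampleLaw {d : ℕ} (S : Matrix (Fin d) (Fin d) ℝ) (σ : ℝ) :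
    Measure (EuclideanSpace ℝ (Fin d) × ℝ) :=
  (multivariateGaussian 0 S).prod (gaussianReal 0 (σ ^ 2).toNNReal)

/-! ### Moments of linear functionals of one sample. -/

section SampleLaw

variable {d : ℕ} {S : Matrix (Fin d) (Fin d) ℝ} {σ : ℝ}

lemma memLp_sampleLaw (L : StrongDual ℝ (EuclideanSpace ℝ (Fin d) × ℝ)) {p : ℝ≥0∞} (hp : p ≠ ∞) :
    MemLp L p (sampleLaw S σ) :=
  IsGaussian.memLp_dual _ L p hp

lemma memLp_four_mul_sampleLaw (L L' : StrongDual ℝ (EuclideanSpace ℝ (Fin d) × ℝ)) :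
    MemLp (fun z => L z * L' z) 4 (sampleLaw S σ) := by
  have : ENNReal.HolderTriple 8 8 4 := ⟨by
    rw [← two_mul, show (8 : ℝ≥0∞) = 2 * 4 by norm_num,
      ENNReal.mul_inv (by simp) (by simp), ← mul_assoc,
      ENNReal.mul_inv_cancel (by simp) (by simp), one_mul]⟩
  exact (memLp_sampleLaw L' (p := 8) (by simp)).mul' (memLp_sampleLaw L (p := 8) (by simp))

lemma integral_sampleLaw (L : StrongDual ℝ (EuclideanSpace ℝ (Fin d) × ℝ)) :
    ∫ z, L z ∂(sampleLaw S σ) = 0 := by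
  have h1 : ∀ z : EuclideanSpace ℝ (Fin d) × ℝ,
      L z = L.comp (ContinuousLinearMap.inl ℝ _ _) z.1 + L.comp (ContinuousLinearMap.inr ℝ _ _) z.2 := by
    intro z
    simp only [ContinuousLinearMap.comp_apply, ← map_add]
    simp
  have i1 : Integrable (L.comp (ContinuousLinearMap.inl ℝ (EuclideanSpace ℝ (Fin d)) ℝ))
    (multivariateGaussian 0 S) := IsGaussian.integrable_dual _ _
  have i2 : Integrable (L.comp (ContinuousLinearMap.inr ℝ (EuclideanSpace ℝ (Fin d)) ℝ))
    (gaussianReal 0 (σ ^ 2).toNNReal) := IsGaussian.integrable_dual _ _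
  simp_rw [h1]
  rw [integral_add (i1.comp_fst _) (i2.comp_snd _), integral_fun_fst, integral_fun_snd,
    ContinuousLinearMap.integral_comp_id_comm, ContinuousLinearMap.integral_comp_id_comm]
  · have h0 : L (0, 0) = 0 := map_zero L
    simpa using h0
  · exact IsGaussian.integrable_id
  · exact IsGaussian.integrable_id

/-- The linear functional `(x, ξ) ↦ ⟨y, x⟩ + s ξ`. -/
noncomputable def sampleFunctional (y : EuclideanSpace ℝ (Fin d)) (s : ℝ) :
    StrongDual ℝ (EuclideanSpace ℝ (Fin d) × ℝ) :=
  (innerSL ℝ y).comp (ContinuousLinearMap.fst ℝ _ _) + s • ContinuousLinearMap.snd ℝ _ _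

lemma sampleFunctional_apply (y : EuclideanSpace ℝ (Fin d)) (s : ℝ)
    (z : EuclideanSpace ℝ (Fin d) × ℝ) : sampleFunctional y s z = inner ℝ y z.1 + s * z.2 := by
  simp [sampleFunctional]

lemma covariance_sampleFunctional (hS : S.PosSemidef) (y y' : EuclideanSpace ℝ (Fin d))
    (s s' : ℝ) :
    cov[sampleFunctional y s, sampleFunctional y' s'; sampleLaw S σ]
      = y.ofLp ⬝ᵥ S *ᵥ y'.ofLp + s * s' * σ ^ 2 := by
  have hf : ∀ (y : EuclideanSpace ℝ (Fin d)) (s : ℝ), (sampleFunctional y s : _ → ℝ)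
      = (fun z => inner ℝ y z.1) + fun z => s * z.2 := fun y s =>
    funext fun z => sampleFunctional_apply y s z
  have m1 : ∀ y : EuclideanSpace ℝ (Fin d), MemLp (fun z : EuclideanSpace ℝ (Fin d) × ℝ =>
      inner ℝ y z.1) 2 (sampleLaw S σ) := fun y =>
    memLp_sampleLaw ((innerSL ℝ y).comp (ContinuousLinearMap.fst ℝ _ _)) (by simp)
  have m2 : MemLp (fun z : EuclideanSpace ℝ (Fin d) × ℝ => z.2) 2 (sampleLaw S σ) :=
    memLp_sampleLaw (ContinuousLinearMap.snd ℝ _ _) (by simp)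
  have c12 : ∀ y : EuclideanSpace ℝ (Fin d), cov[fun z : EuclideanSpace ℝ (Fin d) × ℝ =>
      inner ℝ y z.1, fun z => z.2; sampleLaw S σ] = 0 := fun y =>
    covariance_fst_snd_prod (X := fun x => inner ℝ y x) (Y := fun x => x)
      (IsGaussian.memLp_dual _ (innerSL ℝ y) 2 (by simp)) (memLp_id_gaussianReal 2)
  have c11 : cov[fun z : EuclideanSpace ℝ (Fin d) × ℝ => inner ℝ y z.1, fun z => inner ℝ y' z.1;
      sampleLaw S σ] = y.ofLp ⬝ᵥ S *ᵥ y'.ofLp := by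
    rw [← covarianceBilin_multivariateGaussian (μ := 0) hS, covarianceBilin_apply_eq_cov
      IsGaussian.memLp_two_id]
    exact (measurePreserving_fst (μ := multivariateGaussian 0 S)).hasLaw.covariance_fun_comp
      (by fun_prop) (by fun_prop)
  have c22 : cov[fun z : EuclideanSpace ℝ (Fin d) × ℝ => z.2, fun z => z.2; sampleLaw S σ]
      = σ ^ 2 := by
    rw [covariance_self measurable_snd.aemeasurable]
    have := (measurePreserving_snd (μ := multivariateGaussian 0 S)
      (ν := gaussianReal 0 (σ ^ 2).toNNReal)).variance_fun_comp (f := fun x => x) aemeasurable_id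
    rw [variance_fun_id_gaussianReal, Real.coe_toNNReal _ (sq_nonneg σ)] at this
    exact this
  rw [hf, hf, covariance_add_left (m1 y) (m2.const_mul s) ((m1 y').add (m2.const_mul s')),
    covariance_add_right (m1 y) (m1 y') (m2.const_mul s'),
    covariance_add_right (m2.const_mul s) (m1 y') (m2.const_mul s')]
  simp only [covariance_const_mul_left, covariance_const_mul_right]
  rw [c11, c12, c22, covariance_comm, c12]
  ring

lemma integral_sampleFunctional_mul (hS : S.PosSemidef) (y y' : EuclideanSpace ℝ (Fin d))
    (s s' : ℝ) :
    ∫ z, sampleFunctional y s z * sampleFunctional y' s' z ∂(sampleLaw S σ)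
      = y.ofLp ⬝ᵥ S *ᵥ y'.ofLp + s * s' * σ ^ 2 := by
  rw [← covariance_sampleFunctional hS, covariance_eq_sub (memLp_sampleLaw _ (by simp))
    (memLp_sampleLaw _ (by simp)), integral_sampleLaw, zero_mul, sub_zero]
  rfl

end SampleLaw

/-! ### Moments of the effective noise and of the scores. -/

namespace Views

variable {m d : ℕ} (V : Views m d) {S : Matrix (Fin d) (Fin d) ℝ} {σ : ℝ}

lemma effNoise_eq (θ : EuclideanSpace ℝ (Fin d)) (i : Fin m) :
    V.effNoise S θ i = sampleFunctional (V.residualCoeff S θ i) 1 := by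
  simp [effNoise, sampleFunctional]

/-- The vector with observed part `y` and missing part zero. -/
noncomputable def extend (i : Fin m) (y : EuclideanSpace ℝ (Fin (V.obs i))) :
    EuclideanSpace ℝ (Fin d) :=
  WithLp.toLp 2 fun j => Sum.elim y.ofLp (fun _ => 0) ((V.view i).symm j)

/-- Brings observed features into the form `sampleFunctional`, so that their second moments can be
read off from `S`. -/
lemma inner_plus (i : Fin m) (y : EuclideanSpace ℝ (Fin (V.obs i)))
    (z : EuclideanSpace ℝ (Fin d) × ℝ) :
    inner ℝ (V.plus i z.1) y = sampleFunctional (V.extend i y) 0 z := by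
  rw [sampleFunctional_apply, real_inner_eq_dotProduct, real_inner_eq_dotProduct,
    V.dotProduct_view i (V.extend i y).ofLp]
  simp [extend, plus, dotProduct, mul_comm]

lemma plus_apply_eq (i : Fin m) (a : Fin (V.obs i)) (z : EuclideanSpace ℝ (Fin d) × ℝ) :
    V.plus i z.1 a = sampleFunctional (V.extend i (EuclideanSpace.basisFun _ ℝ a)) 0 z := by
  rw [← V.inner_plus]
  simp [real_inner_eq_dotProduct]

lemma extend_dotProduct (i : Fin m) (y : EuclideanSpace ℝ (Fin (V.obs i))) (x : Fin d → ℝ) :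
    (V.extend i y).ofLp ⬝ᵥ x = y.ofLp ⬝ᵥ fun a => x (V.view i (Sum.inl a)) := by
  rw [V.dotProduct_view i]
  simp [extend, dotProduct]

lemma extend_dotProduct_mulVec (i : Fin m) (y y' : EuclideanSpace ℝ (Fin (V.obs i))) :
    (V.extend i y).ofLp ⬝ᵥ S *ᵥ (V.extend i y').ofLp = y.ofLp ⬝ᵥ V.blockPP i S *ᵥ y'.ofLp := by
  rw [V.extend_dotProduct]
  congr 1
  ext a
  rw [mulVec, dotProduct_comm, V.extend_dotProduct, dotProduct_comm]
  rfl

lemma integral_plus_mul_plus (hS : S.PosDef) (i : Fin m) (a b : Fin (V.obs i)) :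
    ∫ z, V.plus i z.1 a * V.plus i z.1 b ∂(sampleLaw S σ) = V.blockPP i S a b := by
  simp_rw [V.plus_apply_eq i]
  rw [integral_sampleFunctional_mul hS.posSemidef, V.extend_dotProduct_mulVec]
  simp

lemma integral_effNoise_mul_inner (hS : S.PosDef) (θ : EuclideanSpace ℝ (Fin d)) (i : Fin m)
    (y : EuclideanSpace ℝ (Fin (V.obs i))) :
    ∫ z, V.effNoise S θ i z * inner ℝ (V.plus i z.1) y ∂(sampleLaw S σ) = 0 := by
  simp_rw [V.inner_plus i, V.effNoise_eq, mul_comm (sampleFunctional (V.residualCoeff S θ i) 1 _)]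
  rw [integral_sampleFunctional_mul hS.posSemidef, V.extend_dotProduct]
  simp_rw [V.mulVec_residualCoeff hS]
  simp [dotProduct]

lemma integral_effNoise_sq (hS : S.PosDef) (θ : EuclideanSpace ℝ (Fin d)) (i : Fin m) :
    ∫ z, V.effNoise S θ i z ^ 2 ∂(sampleLaw S σ) = V.labelVar S σ θ i := by
  simp_rw [sq, V.effNoise_eq]
  rw [integral_sampleFunctional_mul hS.posSemidef, V.residualCoeff_dotProduct hS, labelVar]
  ring

/-- Gaussianity of the features is essential here: uncorrelated becomes independent, and the
fourth-order moment factorizes. The score covariance is thus `v_i(θ) Σ_{i+}`, which is what makes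
the weights `W_i^g` efficient. -/
lemma integral_effNoise_mul_inner_sq (hS : S.PosDef) (θ : EuclideanSpace ℝ (Fin d)) (i : Fin m)
    (y : EuclideanSpace ℝ (Fin (V.obs i))) :
    ∫ z, (V.effNoise S θ i z * inner ℝ (V.plus i z.1) y) ^ 2 ∂(sampleLaw S σ)
      = V.labelVar S σ θ i * (y.ofLp ⬝ᵥ V.blockPP i S *ᵥ y.ofLp) := by
  have hind : IndepFun (V.effNoise S θ i) (sampleFunctional (V.extend i y) 0) (sampleLaw S σ) := by
    refine HasGaussianLaw.indepFun_of_covariance_eq_zero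
      (IsGaussian.hasGaussianLaw_id.map ((V.effNoise S θ i).prod (sampleFunctional (V.extend i y) 0)))
      ?_
    rw [covariance_eq_sub (memLp_sampleLaw _ (by simp)) (memLp_sampleLaw _ (by simp)),
      integral_sampleLaw, zero_mul, sub_zero]
    have := V.integral_effNoise_mul_inner (σ := σ) hS θ i y
    simp_rw [V.inner_plus i] at this
    exact this
  simp_rw [mul_pow, V.inner_plus i]
  rw [hind.integral_fun_comp_mul_comp (f := fun x => x ^ 2) (g := fun x => x ^ 2)
    (by fun_prop) (by fun_prop) (by fun_prop) (by fun_prop), V.integral_effNoise_sq hS]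
  congr 1
  simp_rw [sq]
  rw [integral_sampleFunctional_mul hS.posSemidef, V.extend_dotProduct_mulVec]
  ring

end Views

lemma sum_euclMul {ι : Type*} [Fintype ι] {p q : ℕ} (A : ι → Matrix (Fin p) (Fin q) ℝ)
    (w : EuclideanSpace ℝ (Fin q)) : euclMul (∑ i, A i) w = ∑ i, euclMul (A i) w := by
  ext a
  simp [euclMul, sum_mulVec]

lemma euclMul_sum {ι : Type*} [Fintype ι] {p q : ℕ} (A : Matrix (Fin p) (Fin q) ℝ)
    (w : ι → EuclideanSpace ℝ (Fin q)) : euclMul A (∑ i, w i) = ∑ i, euclMul A (w i) := by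
  ext a
  simp [euclMul, mulVec_sum]

lemma sub_euclMul {p q : ℕ} (A B : Matrix (Fin p) (Fin q) ℝ) (x : EuclideanSpace ℝ (Fin q)) :
    euclMul (A - B) x = euclMul A x - euclMul B x := by
  ext k; simp [euclMul, sub_mulVec]

lemma smul_euclMul {p q : ℕ} (A : Matrix (Fin p) (Fin q) ℝ) (c : ℝ)
    (x : EuclideanSpace ℝ (Fin q)) : euclMul (c • A) x = c • euclMul A x := by
  ext k; simp [euclMul, smul_mulVec]

/-! ### Finite-sample algebra of least squares and of the Collab estimate. -/

namespace Views

variable {m d : ℕ} (V : Views m d) {S : Matrix (Fin d) (Fin d) ℝ} {σ : ℝ}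

/-- The normalized Gram matrix of the observed features of agent `i`. -/
noncomputable def meanGram (i : Fin m) {n : ℕ} (z : Fin n → EuclideanSpace ℝ (Fin d) × ℝ) :
    Matrix (Fin (V.obs i)) (Fin (V.obs i)) ℝ :=
  (n : ℝ)⁻¹ • designGram fun k => V.plus i (z k).1

/-- The mean of the effective noise times the observed features. -/
noncomputable def meanScore (S : Matrix (Fin d) (Fin d) ℝ) (θ : EuclideanSpace ℝ (Fin d))
    (i : Fin m) {n : ℕ} (z : Fin n → EuclideanSpace ℝ (Fin d) × ℝ) :
    EuclideanSpace ℝ (Fin (V.obs i)) :=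
  (n : ℝ)⁻¹ • ∑ k, V.effNoise S θ i (z k) • V.plus i (z k).1

/-- The mean square of the effective noise. -/
noncomputable def meanNoiseSq (S : Matrix (Fin d) (Fin d) ℝ) (θ : EuclideanSpace ℝ (Fin d))
    (i : Fin m) {n : ℕ} (z : Fin n → EuclideanSpace ℝ (Fin d) × ℝ) : ℝ :=
  (n : ℝ)⁻¹ * ∑ k, V.effNoise S θ i (z k) ^ 2

lemma inner_meanScore (θ : EuclideanSpace ℝ (Fin d)) (i : Fin m) {n : ℕ}
    (z : Fin n → EuclideanSpace ℝ (Fin d) × ℝ) (y : EuclideanSpace ℝ (Fin (V.obs i))) :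
    inner ℝ (V.meanScore S θ i z) y
      = (n : ℝ)⁻¹ * ∑ k, V.effNoise S θ i (z k) * inner ℝ (V.plus i (z k).1) y := by
  rw [meanScore, real_inner_smul_left, sum_inner]
  simp_rw [real_inner_smul_left]

lemma meanScore_apply (θ : EuclideanSpace ℝ (Fin d)) (i : Fin m) {n : ℕ}
    (z : Fin n → EuclideanSpace ℝ (Fin d) × ℝ) (a : Fin (V.obs i)) :
    V.meanScore S θ i z a
      = (n : ℝ)⁻¹ * ∑ k, V.effNoise S θ i (z k) * V.plus i (z k).1 a := by
  simp [meanScore]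

lemma inner_euclMul_meanGram (i : Fin m) {n : ℕ} (z : Fin n → EuclideanSpace ℝ (Fin d) × ℝ)
    (y : EuclideanSpace ℝ (Fin (V.obs i))) :
    inner ℝ y (euclMul (V.meanGram i z) y)
      = (n : ℝ)⁻¹ * ∑ k, inner ℝ (V.plus i (z k).1) y ^ 2 := by
  rw [real_inner_eq_dotProduct, euclMul, meanGram, smul_mulVec, dotProduct_smul, smul_eq_mul,
    ← mulVec_mulVec, dotProduct_mulVec, vecMul_transpose]
  simp_rw [real_inner_eq_dotProduct, sq]
  rfl

lemma localOLS_eq (θ : EuclideanSpace ℝ (Fin d)) {n : ℕ} (hn : n ≠ 0)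
    (z : Fin m → Fin n → EuclideanSpace ℝ (Fin d) × ℝ) (i : Fin m)
    (hG : IsUnit (V.meanGram i (z i))) :
    V.localOLS (fun i k => (z i k).1) (fun i k => inner ℝ (z i k).1 θ + (z i k).2) i
      = euclMul (V.transfer S i) θ + euclMul (V.meanGram i (z i))⁻¹ (V.meanScore S θ i (z i)) := by
  have hn' : (n : ℝ) ≠ 0 := Nat.cast_ne_zero.2 hn
  set A : Matrix (Fin n) (Fin (V.obs i)) ℝ := Matrix.of fun k => (V.plus i (z i k).1).ofLp with hA
  have hGA : V.meanGram i (z i) = (n : ℝ)⁻¹ • (Aᵀ * A) := rfl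
  have hdet : IsUnit (V.meanGram i (z i)).det := (Matrix.isUnit_iff_isUnit_det _).1 hG
  have hinv : (Aᵀ * A)⁻¹ = (n : ℝ)⁻¹ • (V.meanGram i (z i))⁻¹ := by
    refine Matrix.inv_eq_left_inv ?_
    rw [Matrix.smul_mul, ← Matrix.mul_smul, ← hGA, nonsing_inv_mul _ hdet]
  have hdetA : IsUnit (Aᵀ * A).det := by
    have : Aᵀ * A = (n : ℝ) • V.meanGram i (z i) := by rw [hGA, smul_smul, mul_inv_cancel₀ hn', one_smul]
    rw [this, det_smul]
    exact (IsUnit.mk0 _ (pow_ne_zero _ hn')).mul hdet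
  have hy : (fun k => inner ℝ (z i k).1 θ + (z i k).2)
      = A *ᵥ (euclMul (V.transfer S i) θ).ofLp + fun k => V.effNoise S θ i (z i k) := by
    ext k
    rw [V.label_eq (S := S) θ i, real_inner_eq_dotProduct]
    rfl
  have hs : (V.meanScore S θ i (z i)).ofLp
      = (n : ℝ)⁻¹ • (Aᵀ *ᵥ fun k => V.effNoise S θ i (z i k)) := by
    ext a
    rw [V.meanScore_apply, Pi.smul_apply, smul_eq_mul, mulVec, dotProduct]
    simp [hA, mul_comm]
  rw [localOLS, olsEstimate, hy, ← hA, mulVec_add, mulVec_mulVec, mulVec_add, mulVec_mulVec,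
    nonsing_inv_mul _ hdetA, one_mulVec, hinv, smul_mulVec, ← mulVec_smul, ← hs]
  rfl

/-- Pythagoras: fitting removes from the noise its projection onto the observed features. The
correction is quadratic in the score, so it disappears in the limit. -/
lemma residual_eq (θ : EuclideanSpace ℝ (Fin d)) {n : ℕ} (hn : n ≠ 0)
    (z : Fin m → Fin n → EuclideanSpace ℝ (Fin d) × ℝ) (i : Fin m)
    (hG : IsUnit (V.meanGram i (z i))) :
    V.residual (fun i k => (z i k).1) (fun i k => inner ℝ (z i k).1 θ + (z i k).2) i
      = V.meanNoiseSq S θ i (z i) - inner ℝ (V.meanScore S θ i (z i))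
          (euclMul (V.meanGram i (z i))⁻¹ (V.meanScore S θ i (z i))) := by
  have hdet : IsUnit (V.meanGram i (z i)).det := (Matrix.isUnit_iff_isUnit_det _).1 hG
  rw [residual, V.localOLS_eq (S := S) θ hn z i hG]
  set r := euclMul (V.meanGram i (z i))⁻¹ (V.meanScore S θ i (z i)) with hr
  have h1 : euclMul (V.meanGram i (z i)) r = V.meanScore S θ i (z i) := by
    rw [hr, euclMul_euclMul, mul_nonsing_inv _ hdet, euclMul_one]
  have h2 := V.inner_euclMul_meanGram i (z i) r
  have h3 := V.inner_meanScore (S := S) θ i (z i) r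
  rw [h1, real_inner_comm] at h2
  have h4 : ∀ k, (inner ℝ (V.plus i (z i k).1) (euclMul (V.transfer S i) θ + r)
      - (inner ℝ (z i k).1 θ + (z i k).2)) ^ 2 = inner ℝ (V.plus i (z i k).1) r ^ 2
        - 2 * (V.effNoise S θ i (z i k) * inner ℝ (V.plus i (z i k).1) r)
        + V.effNoise S θ i (z i k) ^ 2 := fun k => by
    rw [V.label_eq (S := S) θ i, inner_add_right]; ring
  simp_rw [h4]
  rw [Finset.sum_add_distrib, Finset.sum_sub_distrib, ← Finset.mul_sum, mul_add, mul_sub, ← h2,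
    mul_left_comm, ← h3, meanNoiseSq]
  ring

lemma weightedRisk_add_smul
    {W : (i : Fin m) → Matrix (Fin (V.obs i)) (Fin (V.obs i)) ℝ} (hW : ∀ i, (W i)ᵀ = W i)
    (z : (i : Fin m) → EuclideanSpace ℝ (Fin (V.obs i))) (ϑ h : EuclideanSpace ℝ (Fin d)) (t : ℝ) :
    V.weightedRisk S W z (ϑ + t • h) = V.weightedRisk S W z ϑ
      + 2 * t * inner ℝ h (∑ i, euclMul ((V.transfer S i)ᵀ * W i) (euclMul (V.transfer S i) ϑ - z i))
      + t ^ 2 * ∑ i, inner ℝ (euclMul (V.transfer S i) h)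
          (euclMul (W i) (euclMul (V.transfer S i) h)) := by
  rw [inner_sum, Finset.mul_sum, Finset.mul_sum, weightedRisk, weightedRisk,
    ← Finset.sum_add_distrib, ← Finset.sum_add_distrib]
  refine Finset.sum_congr rfl fun i _ => ?_
  set T := V.transfer S i
  set r := euclMul T ϑ - z i with hr
  set g := euclMul T h with hg
  have h0 : euclMul T (ϑ + t • h) - z i = r + t • g := by
    rw [euclMul_add, euclMul_smul, hr, hg]; abel
  have hq : ∀ v : EuclideanSpace ℝ (Fin (V.obs i)),
      v.ofLp ⬝ᵥ W i *ᵥ v.ofLp = inner ℝ v (euclMul (W i) v) := fun v => by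
    rw [real_inner_eq_dotProduct]; rfl
  have h1 : inner ℝ h (euclMul (Tᵀ * W i) r) = inner ℝ g (euclMul (W i) r) := by
    rw [← euclMul_euclMul, hg, inner_euclMul]
  have h2 : inner ℝ r (euclMul (W i) g) = inner ℝ g (euclMul (W i) r) := by
    rw [real_inner_comm, inner_euclMul, hW]
  rw [h0, hq, hq, h1, euclMul_add, euclMul_smul]
  simp only [inner_add_left, inner_add_right, real_inner_smul_left, real_inner_smul_right]
  rw [h2]
  ring

/-- Perturbing along the candidate gradient `g` itself forces `⟨g, g⟩ = 0`. Symmetric weights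
suffice; positivity plays no role. -/
lemma normal_equation
    {W : (i : Fin m) → Matrix (Fin (V.obs i)) (Fin (V.obs i)) ℝ} (hW : ∀ i, (W i)ᵀ = W i)
    {z : (i : Fin m) → EuclideanSpace ℝ (Fin (V.obs i))} {ϑ : EuclideanSpace ℝ (Fin d)}
    (h : IsMinOn (V.weightedRisk S W z) Set.univ ϑ) :
    ∑ i, euclMul ((V.transfer S i)ᵀ * W i) (euclMul (V.transfer S i) ϑ - z i) = 0 := by
  set g := ∑ i, euclMul ((V.transfer S i)ᵀ * W i) (euclMul (V.transfer S i) ϑ - z i) with hg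
  refine (inner_self_eq_zero (𝕜 := ℝ)).1 (eq_zero_of_forall_quadratic_nonneg
    (q := ∑ i, inner ℝ (euclMul (V.transfer S i) g) (euclMul (W i) (euclMul (V.transfer S i) g)))
    fun t => ?_)
  have h1 : V.weightedRisk S W z ϑ ≤ V.weightedRisk S W z (ϑ + t • g) := h (Set.mem_univ _)
  rw [V.weightedRisk_add_smul hW, ← hg] at h1
  linarith

/-- The error of a Collab estimate, as a linear function of the mean scores. -/
lemma IsCollab.euclMul_sub_eq (hS : S.PosDef) {θ : EuclideanSpace ℝ (Fin d)} {n : ℕ} (hn : n ≠ 0)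
    {z : Fin m → Fin n → EuclideanSpace ℝ (Fin d) × ℝ} {ϑ : EuclideanSpace ℝ (Fin d)}
    (h : V.IsCollab S (fun i k => (z i k).1) (fun i k => inner ℝ (z i k).1 θ + (z i k).2) ϑ)
    (hG : ∀ i, IsUnit (V.meanGram i (z i))) (v : Fin m → ℝ)
    (hv : v = V.residual (fun i k => (z i k).1) (fun i k => inner ℝ (z i k).1 θ + (z i k).2)) :
    euclMul (∑ i, (V.transfer S i)ᵀ * ((v i)⁻¹ • V.blockPP i S) * V.transfer S i) (ϑ - θ)
      = ∑ i, euclMul ((V.transfer S i)ᵀ * ((v i)⁻¹ • V.blockPP i S) * (V.meanGram i (z i))⁻¹)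
          (V.meanScore S θ i (z i)) := by
  have h1 := V.normal_equation (fun i => by
    rw [transpose_smul]
    congr 1
    simpa [IsHermitian] using (V.blockPP_posDef hS i).isHermitian) h
  rw [← hv] at h1
  rw [sum_euclMul, ← sub_eq_zero, ← Finset.sum_sub_distrib, ← h1]
  refine Finset.sum_congr rfl fun i _ => ?_
  rw [V.localOLS_eq (S := S) θ hn z i (hG i)]
  simp only [euclMul_sub, euclMul_add, euclMul_euclMul, Matrix.mul_assoc]
  abel

end Views

/-! ### Linearization of the Collab error. -/

namespace Views

variable {m d : ℕ} (V : Views m d) {S : Matrix (Fin d) (Fin d) ℝ} {σ : ℝ}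

/-- The leading term `∑ i, v_i⁻¹ T_iᵀ √n B_i` of the normalized score of the Collab estimate. -/
noncomputable def totalScore (S : Matrix (Fin d) (Fin d) ℝ) (σ : ℝ) (θ : EuclideanSpace ℝ (Fin d))
    {n : ℕ} (z : Fin m → Fin n → EuclideanSpace ℝ (Fin d) × ℝ) : EuclideanSpace ℝ (Fin d) :=
  ∑ i, euclMul ((V.labelVar S σ θ i)⁻¹ • (V.transfer S i)ᵀ) (√(n : ℝ) • V.meanScore S θ i (z i))

/-- The sum of the fourth powers of the coordinates of the normalized mean scores. -/
noncomputable def scoreSize (S : Matrix (Fin d) (Fin d) ℝ) (θ : EuclideanSpace ℝ (Fin d))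
    {n : ℕ} (z : Fin m → Fin n → EuclideanSpace ℝ (Fin d) × ℝ) : ℝ :=
  ∑ i, ∑ a, (√(n : ℝ) * V.meanScore S θ i (z i) a) ^ 4

lemma scoreSize_nonneg (θ : EuclideanSpace ℝ (Fin d)) {n : ℕ}
    (z : Fin m → Fin n → EuclideanSpace ℝ (Fin d) × ℝ) : 0 ≤ V.scoreSize S θ z :=
  Finset.sum_nonneg fun _ _ => Finset.sum_nonneg fun _ _ => by positivity

/-- `|t| ≤ 1 + t⁴` trades first powers for the fourth powers whose expectations are controlled. -/
lemma sum_abs_meanScore_le (θ : EuclideanSpace ℝ (Fin d)) {n : ℕ}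
    (z : Fin m → Fin n → EuclideanSpace ℝ (Fin d) × ℝ) (i : Fin m) :
    ∑ a, |(√(n : ℝ) • V.meanScore S θ i (z i)) a| ≤ (V.obs i + 1) * (1 + V.scoreSize S θ z) := by
  have h : ∀ t : ℝ, |t| ≤ 1 + t ^ 4 := fun t => by
    have : t ^ 4 = |t| ^ 4 := by rw [← abs_pow, abs_of_nonneg (by positivity)]
    rw [this]
    nlinarith [sq_nonneg (|t| ^ 2 - 1), sq_nonneg (|t| - 1), abs_nonneg t]
  have h1 : ∑ a, |(√(n : ℝ) • V.meanScore S θ i (z i)) a|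
      ≤ V.obs i + ∑ a, (√(n : ℝ) * V.meanScore S θ i (z i) a) ^ 4 := by
    refine (Finset.sum_le_sum fun a _ => h _).trans ?_
    rw [Finset.sum_add_distrib]
    simp
  have h2 : ∑ a, (√(n : ℝ) * V.meanScore S θ i (z i) a) ^ 4 ≤ V.scoreSize S θ z :=
    Finset.single_le_sum (f := fun i => ∑ a, (√(n : ℝ) * V.meanScore S θ i (z i) a) ^ 4)
      (fun _ _ => Finset.sum_nonneg fun _ _ => by positivity) (Finset.mem_univ i)
  have h3 := V.scoreSize_nonneg (S := S) θ z
  nlinarith [mul_nonneg (Nat.cast_nonneg (α := ℝ) (V.obs i)) h3]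

lemma tendsto_residual (hS : S.PosDef) {θ : EuclideanSpace ℝ (Fin d)}
    {z : (n : ℕ) → Fin m → Fin n → EuclideanSpace ℝ (Fin d) × ℝ} (i : Fin m)
    (hG : Tendsto (fun n => V.meanGram i (z n i)) atTop (nhds (V.blockPP i S)))
    (hB : Tendsto (fun n => V.meanScore S θ i (z n i)) atTop (nhds 0))
    (hN : Tendsto (fun n => V.meanNoiseSq S θ i (z n i)) atTop (nhds (V.labelVar S σ θ i))) :
    Tendsto (fun n => V.residual (fun i k => (z n i k).1)
      (fun i k => inner ℝ (z n i k).1 θ + (z n i k).2) i) atTop (nhds (V.labelVar S σ θ i)) := by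
  have hu := (V.blockPP_posDef hS i).isUnit
  have hinv := tendsto_matrix_inv hG hu
  have hc : Continuous fun q : Matrix (Fin (V.obs i)) (Fin (V.obs i)) ℝ
      × EuclideanSpace ℝ (Fin (V.obs i)) => inner ℝ q.2 (euclMul q.1 q.2) := by
    unfold euclMul
    fun_prop
  have h := hN.sub ((hc.tendsto _).comp (hinv.prodMk_nhds hB))
  simp only [inner_zero_left, sub_zero] at h
  refine h.congr' ?_
  filter_upwards [eventually_isUnit_of_tendsto hG hu, eventually_ne_atTop 0] with n hn hn0
  rw [V.residual_eq (S := S) θ hn0 (z n) i hn]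
  rfl

/-- The normalized error of the Collab estimate differs from `C` times the total score by a term
that is negligible against the scores. -/
lemma tendsto_norm_collab_sub_div (hS : S.PosDef) (hσ : 0 < σ) {θ : EuclideanSpace ℝ (Fin d)}
    (hC : IsUnit (V.precision S σ θ))
    {z : (n : ℕ) → Fin m → Fin n → EuclideanSpace ℝ (Fin d) × ℝ}
    (hG : ∀ i, Tendsto (fun n => V.meanGram i (z n i)) atTop (nhds (V.blockPP i S)))
    (hB : ∀ i, Tendsto (fun n => V.meanScore S θ i (z n i)) atTop (nhds 0))
    (hN : ∀ i, Tendsto (fun n => V.meanNoiseSq S θ i (z n i)) atTop (nhds (V.labelVar S σ θ i)))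
    {est : ℕ → EuclideanSpace ℝ (Fin d)}
    (hest : ∀ n, V.IsCollab S (fun i k => (z n i k).1)
      (fun i k => inner ℝ (z n i k).1 θ + (z n i k).2) (est n)) :
    Tendsto (fun n : ℕ => ‖√(n : ℝ) • (est n - θ) - euclMul (V.covG S σ θ) (V.totalScore S σ θ (z n))‖
      / (1 + V.scoreSize S θ (z n))) atTop (nhds 0) := by
  set v : ℕ → Fin m → ℝ := fun n => V.residual (fun i k => (z n i k).1)
      (fun i k => inner ℝ (z n i k).1 θ + (z n i k).2) with hv
  have hres : ∀ i, Tendsto (fun n => v n i) atTop (nhds (V.labelVar S σ θ i)) := fun i =>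
    V.tendsto_residual hS i (hG i) (hB i) (hN i)
  have hW : ∀ i, Tendsto (fun n => (V.transfer S i)ᵀ * ((v n i)⁻¹ • V.blockPP i S)) atTop
      (nhds ((V.transfer S i)ᵀ * V.gaussWeight S σ θ i)) := fun i =>
    ((continuous_const.matrix_mul continuous_id).tendsto _).comp
      (((hres i).inv₀ (V.labelVar_pos hS hσ θ i).ne').smul_const (V.blockPP i S))
  set H : ℕ → Matrix (Fin d) (Fin d) ℝ := fun n =>
    ∑ i, (V.transfer S i)ᵀ * ((v n i)⁻¹ • V.blockPP i S) * V.transfer S i with hH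
  have hHt : Tendsto H atTop (nhds (V.precision S σ θ)) :=
    tendsto_finsetSum _ fun i _ => ((continuous_id.matrix_mul continuous_const).tendsto _).comp (hW i)
  set M : ℕ → (i : Fin m) → Matrix (Fin d) (Fin (V.obs i)) ℝ := fun n i =>
    (H n)⁻¹ * ((V.transfer S i)ᵀ * ((v n i)⁻¹ • V.blockPP i S) * (V.meanGram i (z n i))⁻¹)
      - V.covG S σ θ * ((V.labelVar S σ θ i)⁻¹ • (V.transfer S i)ᵀ) with hM
  have hMt : ∀ i, Tendsto (fun n => M n i) atTop (nhds 0) := by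
    intro i
    have hdet : IsUnit (V.blockPP i S).det :=
      (Matrix.isUnit_iff_isUnit_det _).1 (V.blockPP_posDef hS i).isUnit
    have hmul : Continuous fun q : Matrix (Fin d) (Fin d) ℝ × Matrix (Fin d) (Fin (V.obs i)) ℝ
        × Matrix (Fin (V.obs i)) (Fin (V.obs i)) ℝ => q.1 * (q.2.1 * q.2.2) := by fun_prop
    have h1 := (hmul.tendsto _).comp ((tendsto_matrix_inv hHt hC).prodMk_nhds ((hW i).prodMk_nhds
      (tendsto_matrix_inv (hG i) (V.blockPP_posDef hS i).isUnit)))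
    have h2 := h1.sub_const (V.covG S σ θ * ((V.labelVar S σ θ i)⁻¹ • (V.transfer S i)ᵀ))
    refine h2.trans (le_of_eq ?_)
    -- In the limit the weight cancels the inverse Gram matrix, `W_i^g Σ_{i+}⁻¹ = v_i(θ)⁻¹ I`, which
    -- leaves the coefficient used in `totalScore`.
    have h3 : V.gaussWeight S σ θ i = (V.labelVar S σ θ i)⁻¹ • V.blockPP i S := rfl
    simp only [h3, Matrix.mul_smul, Matrix.smul_mul]
    rw [Matrix.mul_assoc, mul_nonsing_inv _ hdet, Matrix.mul_one]
    exact congrArg nhds (sub_self _)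
  have hbound : ∀ᶠ n : ℕ in atTop,
      ‖√(n : ℝ) • (est n - θ) - euclMul (V.covG S σ θ) (V.totalScore S σ θ (z n))‖
        / (1 + V.scoreSize S θ (z n)) ≤ ∑ i, (∑ a, ∑ b, |M n i a b|) * (V.obs i + 1) := by
    filter_upwards [eventually_all.2 fun i =>
      eventually_isUnit_of_tendsto (hG i) (V.blockPP_posDef hS i).isUnit,
      eventually_isUnit_of_tendsto hHt hC, eventually_ne_atTop 0] with n hn hHn hn0
    have hdet : IsUnit (H n).det := (Matrix.isUnit_iff_isUnit_det _).1 hHn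
    have h1 := IsCollab.euclMul_sub_eq V hS hn0 (hest n) hn (v n) rfl
    have h2 : est n - θ = ∑ i, euclMul ((H n)⁻¹ * ((V.transfer S i)ᵀ * ((v n i)⁻¹ • V.blockPP i S)
        * (V.meanGram i (z n i))⁻¹)) (V.meanScore S θ i (z n i)) := by
      have := congrArg (euclMul (H n)⁻¹) h1
      rw [euclMul_euclMul, nonsing_inv_mul _ hdet, euclMul_one, euclMul_sum] at this
      simpa only [euclMul_euclMul] using this
    have h3 : √(n : ℝ) • (est n - θ) - euclMul (V.covG S σ θ) (V.totalScore S σ θ (z n))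
        = ∑ i, euclMul (M n i) (√(n : ℝ) • V.meanScore S θ i (z n i)) := by
      rw [h2, totalScore, euclMul_sum, Finset.smul_sum, ← Finset.sum_sub_distrib]
      refine Finset.sum_congr rfl fun i _ => ?_
      rw [hM, sub_euclMul, ← euclMul_smul, euclMul_euclMul]
    have hpos : 0 < 1 + V.scoreSize S θ (z n) := by linarith [V.scoreSize_nonneg (S := S) θ (z n)]
    rw [div_le_iff₀ hpos, h3, Finset.sum_mul]
    refine (norm_sum_le _ _).trans (Finset.sum_le_sum fun i _ => ?_)
    rw [mul_assoc]
    exact (norm_euclMul_le _ _).trans (mul_le_mul_of_nonneg_left (V.sum_abs_meanScore_le θ (z n) i)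
      (Finset.sum_nonneg fun _ _ => Finset.sum_nonneg fun _ _ => abs_nonneg _))
  have hlim : Tendsto (fun n => ∑ i, (∑ a, ∑ b, |M n i a b|) * (V.obs i + 1 : ℝ)) atTop (nhds 0) := by
    have hc : ∀ i, Continuous fun A : Matrix (Fin d) (Fin (V.obs i)) ℝ =>
        (∑ a, ∑ b, |A a b|) * (V.obs i + 1 : ℝ) := fun i => by fun_prop
    have := tendsto_finsetSum Finset.univ fun i _ => ((hc i).tendsto _).comp (hMt i)
    simpa using this
  refine tendsto_of_tendsto_of_tendsto_of_le_of_le' tendsto_const_nhds hlim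
    (Eventually.of_forall fun n => ?_) hbound
  have := V.scoreSize_nonneg (S := S) θ (z n)
  positivity

end Views

/-! ### Central limit theorem for the scores and asymptotic normality of Collab. -/

lemma charFun_map_sum_eq_prod_pow {Ω 𝓧 : Type*} [MeasurableSpace Ω] [MeasurableSpace 𝓧]
    {P : Measure Ω} {ν : Measure 𝓧} {m n : ℕ} {Z : Fin m × Fin n → Ω → 𝓧}
    (hlaw : ∀ p, HasLaw (Z p) ν P) (hind : iIndepFun Z P) {f : Fin m → 𝓧 → ℝ}
    (hf : ∀ i, Measurable (f i)) (r : ℝ) :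
    charFun (P.map fun ω => ∑ p, r * f p.1 (Z p ω)) 1 = ∏ i, charFun (ν.map (f i)) r ^ n := by
  have hm : ∀ p, AEMeasurable (fun ω => f p.1 (Z p ω)) P := fun p =>
    (hf p.1).comp_aemeasurable (hlaw p).aemeasurable
  have hind' : iIndepFun (fun p ω => r * f p.1 (Z p ω)) P :=
    hind.comp (fun p y => r * f p.1 y) fun p => (hf p.1).const_mul r
  have h (p : Fin m × Fin n) :
      charFun (P.map fun ω => r * f p.1 (Z p ω)) 1 = charFun (ν.map (f p.1)) r := by
    have hmap : P.map (fun ω => f p.1 (Z p ω)) = ν.map (f p.1) := by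
      rw [← (hlaw p).map_eq, AEMeasurable.map_map_of_aemeasurable (hf p.1).aemeasurable
        (hlaw p).aemeasurable]
      rfl
    rw [charFun_map_mul_comp (hm p), hmap, mul_one]
  rw [iIndepFun.charFun_map_fun_sum_eq_prod (fun p => (hm p).const_mul r) hind',
    Finset.prod_apply, Finset.prod_congr rfl fun p _ => h p, Fintype.prod_prod_type]
  simp

namespace IsGaussianData

variable {m d : ℕ} {S : Matrix (Fin d) (Fin d) ℝ} {σ : ℝ} {Ω : Type*} [MeasurableSpace Ω]
  {P : Measure Ω} {x : (n : ℕ) → Fin m → Fin n → Ω → EuclideanSpace ℝ (Fin d)}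
  {ξ : (n : ℕ) → Fin m → Fin n → Ω → ℝ}

lemma indep_agent (h : IsGaussianData S σ x ξ P) (i : Fin m) (n : ℕ) :
    iIndepFun (fun k ω => (x n i k ω, ξ n i k ω)) P :=
  (h.indep n).precomp (g := fun k => (i, k)) fun _ _ hk => (Prod.ext_iff.1 hk).2

variable [IsProbabilityMeasure P]

lemma ae_tendsto_mean (h : IsGaussianData S σ x ξ P) (i : Fin m)
    (L L' : StrongDual ℝ (EuclideanSpace ℝ (Fin d) × ℝ)) :
    ∀ᵐ ω ∂P, Tendsto (fun n : ℕ => (n : ℝ)⁻¹ * ∑ k, L (x n i k ω, ξ n i k ω)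
      * L' (x n i k ω, ξ n i k ω)) atTop (nhds (∫ z, L z * L' z ∂(sampleLaw S σ))) :=
  ae_tendsto_rowMean (Z := fun n k ω => (x n i k ω, ξ n i k ω)) (fun n k => h.law n i k)
    (h.indep_agent i) (f := fun z => L z * L' z) (by fun_prop) (memLp_four_mul_sampleLaw L L')

variable (V : Views m d)

lemma ae_tendsto_meanGram (h : IsGaussianData S σ x ξ P) (hS : S.PosDef) (i : Fin m) :
    ∀ᵐ ω ∂P, Tendsto (fun n => V.meanGram i fun k => (x n i k ω, ξ n i k ω)) atTop
      (nhds (V.blockPP i S)) := by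
  have h1 : ∀ a b, ∀ᵐ ω ∂P, Tendsto (fun n : ℕ => (n : ℝ)⁻¹ * ∑ k, V.plus i (x n i k ω) a
      * V.plus i (x n i k ω) b) atTop (nhds (V.blockPP i S a b)) := fun a b => by
    have := h.ae_tendsto_mean i (sampleFunctional (V.extend i (EuclideanSpace.basisFun _ ℝ a)) 0)
      (sampleFunctional (V.extend i (EuclideanSpace.basisFun _ ℝ b)) 0)
    simp_rw [← V.plus_apply_eq i] at this
    rwa [V.integral_plus_mul_plus hS] at this
  filter_upwards [ae_all_iff.2 fun a => ae_all_iff.2 (h1 a)] with ω hω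
  exact tendsto_pi_nhds.2 fun a => tendsto_pi_nhds.2 fun b => hω a b

lemma ae_tendsto_meanScore (h : IsGaussianData S σ x ξ P) (hS : S.PosDef)
    (θ : EuclideanSpace ℝ (Fin d)) (i : Fin m) :
    ∀ᵐ ω ∂P, Tendsto (fun n => V.meanScore S θ i fun k => (x n i k ω, ξ n i k ω)) atTop
      (nhds 0) := by
  have h1 : ∀ a, ∀ᵐ ω ∂P, Tendsto (fun n : ℕ => V.meanScore S θ i
      (fun k => (x n i k ω, ξ n i k ω)) a) atTop (nhds 0) := fun a => by
    have := h.ae_tendsto_mean i (V.effNoise S θ i)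
      (sampleFunctional (V.extend i (EuclideanSpace.basisFun _ ℝ a)) 0)
    simp_rw [← V.inner_plus i] at this
    rw [V.integral_effNoise_mul_inner hS] at this
    simp_rw [V.meanScore_apply]
    simpa [real_inner_eq_dotProduct] using this
  filter_upwards [ae_all_iff.2 h1] with ω hω
  exact ((PiLp.continuous_toLp 2 _).tendsto _).comp (tendsto_pi_nhds.2 hω)

lemma ae_tendsto_meanNoiseSq (h : IsGaussianData S σ x ξ P) (hS : S.PosDef)
    (θ : EuclideanSpace ℝ (Fin d)) (i : Fin m) :
    ∀ᵐ ω ∂P, Tendsto (fun n => V.meanNoiseSq S θ i fun k => (x n i k ω, ξ n i k ω)) atTop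
      (nhds (V.labelVar S σ θ i)) := by
  have := h.ae_tendsto_mean i (V.effNoise S θ i) (V.effNoise S θ i)
  simp_rw [← sq] at this
  rwa [V.integral_effNoise_sq hS] at this

/-- Supplies the bound in mean required by `tendstoInMeasure_zero_of_ae_tendsto_div`: fourth moments
of row sums grow like `n²`, which the normalization by `√n` cancels. -/
lemma exists_integral_scoreSize_le (h : IsGaussianData S σ x ξ P) (hS : S.PosDef)
    (θ : EuclideanSpace ℝ (Fin d)) :
    ∃ K : ℝ, ∀ n, Integrable (fun ω => V.scoreSize S θ fun i k => (x n i k ω, ξ n i k ω)) P ∧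
      ∫ ω, V.scoreSize S θ (fun i k => (x n i k ω, ξ n i k ω)) ∂P ≤ K := by
  have h1 : ∀ (i : Fin m) (a : Fin (V.obs i)), ∃ K : ℝ, ∀ n : ℕ,
      Integrable (fun ω => (√(n : ℝ) * V.meanScore S θ i (fun k => (x n i k ω, ξ n i k ω)) a) ^ 4) P ∧
      ∫ ω, (√(n : ℝ) * V.meanScore S θ i (fun k => (x n i k ω, ξ n i k ω)) a) ^ 4 ∂P ≤ K := by
    intro i a
    set L' := sampleFunctional (V.extend i (EuclideanSpace.basisFun _ ℝ a)) 0 with hL'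
    have h0 : ∫ z, V.effNoise S θ i z * L' z ∂(sampleLaw S σ) = 0 := by
      simp_rw [hL', ← V.inner_plus i]
      exact V.integral_effNoise_mul_inner hS θ i _
    obtain ⟨K, hK0, hK⟩ := exists_integral_rowSum_pow_four_le
      (Z := fun n k ω => (x n i k ω, ξ n i k ω)) (fun n k => h.law n i k)
      (h.indep_agent i) (f := fun z => V.effNoise S θ i z * L' z) (by fun_prop)
      (memLp_four_mul_sampleLaw _ _) h0
    refine ⟨K, fun n => ?_⟩
    have heq : ∀ ω, (√(n : ℝ) * V.meanScore S θ i (fun k => (x n i k ω, ξ n i k ω)) a) ^ 4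
        = ((n : ℝ)⁻¹) ^ 2 * (∑ k, V.effNoise S θ i (x n i k ω, ξ n i k ω)
          * L' (x n i k ω, ξ n i k ω)) ^ 4 := fun ω => by
      simp_rw [V.meanScore_apply, hL', ← V.plus_apply_eq i]
      rw [← mul_assoc, mul_pow]
      congr 1
      rw [mul_pow, show √(n : ℝ) ^ 4 = (√(n : ℝ) ^ 2) ^ 2 by ring, Real.sq_sqrt (Nat.cast_nonneg n)]
      rcases eq_or_ne (n : ℝ) 0 with h0 | h0
      · simp [h0]
      · field_simp
    simp_rw [heq]
    refine ⟨(hK n).1.const_mul _, ?_⟩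
    rw [integral_const_mul]
    rcases eq_or_ne (n : ℝ) 0 with h0 | h0
    · simpa [h0] using hK0
    · calc _ ≤ ((n : ℝ)⁻¹) ^ 2 * (K * n ^ 2) := mul_le_mul_of_nonneg_left (hK n).2 (by positivity)
        _ = K := by field_simp
  choose K hK using h1
  refine ⟨∑ i, ∑ a, K i a, fun n => ?_⟩
  have hi : ∀ i, Integrable (fun ω => ∑ a, (√(n : ℝ) * V.meanScore S θ i
      (fun k => (x n i k ω, ξ n i k ω)) a) ^ 4) P := fun i =>
    integrable_finsetSum _ fun a _ => (hK i a n).1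
  refine ⟨integrable_finsetSum _ fun i _ => hi i, ?_⟩
  unfold Views.scoreSize
  rw [integral_finsetSum _ fun i _ => hi i]
  refine Finset.sum_le_sum fun i _ => ?_
  rw [integral_finsetSum _ fun a _ => (hK i a n).1]
  exact Finset.sum_le_sum fun a _ => (hK i a n).2

/-- Central limit theorem for the total score. -/
lemma tendstoInDistribution_totalScore (h : IsGaussianData S σ x ξ P) (hS : S.PosDef) (hσ : 0 < σ)
    (θ : EuclideanSpace ℝ (Fin d)) :
    TendstoInDistribution (fun n ω => V.totalScore S σ θ fun i k => (x n i k ω, ξ n i k ω)) atTop id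
      (fun _ => P) (multivariateGaussian 0 (V.precision S σ θ)) := by
  have hplus : ∀ i, Measurable (V.plus i) := fun i => by unfold Views.plus; fun_prop
  have hzm : ∀ n i k, AEMeasurable (fun ω => (x n i k ω, ξ n i k ω)) P := fun n i k =>
    (h.law n i k).aemeasurable
  have hms : ∀ n, AEMeasurable
      (fun ω => V.totalScore S σ θ fun i k => (x n i k ω, ξ n i k ω)) P := by
    intro n
    refine Finset.aemeasurable_fun_sum _ fun i _ => (measurable_euclMul _).comp_aemeasurable ?_
    have hsum : AEMeasurable (fun ω => ∑ k, V.effNoise S θ i (x n i k ω, ξ n i k ω)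
        • V.plus i (x n i k ω)) P := Finset.aemeasurable_fun_sum _ fun k _ => ?_
    · exact (hsum.const_smul (n : ℝ)⁻¹).const_smul √(n : ℝ)
    exact ((V.effNoise S θ i).measurable.comp_aemeasurable (hzm n i k)).smul
      (((hplus i).comp measurable_fst).comp_aemeasurable (hzm n i k))
  refine ⟨hms, aemeasurable_id, ?_⟩
  refine ProbabilityMeasure.tendsto_iff_tendsto_charFun.2 fun t => ?_
  -- Pairing the total score with `t` reduces the claim to sums of independent real variables,
  -- identically distributed within each agent, so the characteristic function is a product of
  -- `n`-th powers.
  set f : Fin m → EuclideanSpace ℝ (Fin d) × ℝ → ℝ := fun i z => (V.labelVar S σ θ i)⁻¹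
    * (V.effNoise S θ i z * inner ℝ (V.plus i z.1) (euclMul (V.transfer S i) t)) with hf
  have hfm : ∀ i, Measurable (f i) := fun i =>
    ((V.effNoise S θ i).measurable.mul ((hplus i).comp measurable_fst |>.inner_const)).const_mul _
  have hinner : ∀ n ω, inner ℝ (V.totalScore S σ θ fun i k => (x n i k ω, ξ n i k ω)) t
      = ∑ p : Fin m × Fin n, (√(n : ℝ))⁻¹ * f p.1 (x n p.1 p.2 ω, ξ n p.1 p.2 ω) := by
    intro n ω
    rw [Views.totalScore, sum_inner, Fintype.sum_prod_type]
    refine Finset.sum_congr rfl fun i _ => ?_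
    rw [smul_euclMul, real_inner_smul_left, inner_euclMul, transpose_transpose,
      real_inner_smul_left, V.inner_meanScore, ← Finset.mul_sum]
    simp only [hf]
    rw [← Finset.mul_sum]
    have hs : √(n : ℝ) * (n : ℝ)⁻¹ = (√(n : ℝ))⁻¹ := by
      rw [← div_eq_mul_inv, Real.sqrt_div_self', one_div]
    rw [← mul_assoc (√(n : ℝ)), hs]
    ring
  have hchar : ∀ n, charFun (P.map fun ω => V.totalScore S σ θ fun i k => (x n i k ω, ξ n i k ω)) t
      = ∏ i, (charFun ((sampleLaw S σ).map (f i)) (√(n : ℝ))⁻¹) ^ n := by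
    intro n
    have h1 : charFun (P.map fun ω => V.totalScore S σ θ fun i k => (x n i k ω, ξ n i k ω)) t
        = charFun (P.map fun ω => ∑ p : Fin m × Fin n, (√(n : ℝ))⁻¹
          * f p.1 (x n p.1 p.2 ω, ξ n p.1 p.2 ω)) 1 := by
      have h2 : AEMeasurable (fun ω => ∑ p : Fin m × Fin n, (√(n : ℝ))⁻¹
          * f p.1 (x n p.1 p.2 ω, ξ n p.1 p.2 ω)) P :=
        Finset.aemeasurable_fun_sum _ fun p _ =>
          ((hfm p.1).comp_aemeasurable (hzm n p.1 p.2)).const_mul _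
      rw [charFun_apply, charFun_apply, integral_map (hms n) (by fun_prop),
        integral_map h2 (by fun_prop)]
      simp_rw [hinner]
      simp
    rw [h1]
    exact charFun_map_sum_eq_prod_pow (fun p => h.law n p.1 p.2) (h.indep n) hfm _
  have hlim : Tendsto (fun n : ℕ => ∏ i, (charFun ((sampleLaw S σ).map (f i)) (√(n : ℝ))⁻¹) ^ n) atTop
      (nhds (∏ i, Complex.exp (-((V.labelVar S σ θ i)⁻¹ * ((euclMul (V.transfer S i) t).ofLp ⬝ᵥ
        V.blockPP i S *ᵥ (euclMul (V.transfer S i) t).ofLp) : ℝ) / 2))) := by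
    refine tendsto_finsetProd _ fun i _ => ?_
    have hv := V.labelVar_pos hS hσ θ i
    refine tendsto_charFun_pow_of_variance ?_ ?_ ?_
    · refine MemLp.const_mul ?_ _
      have := memLp_four_mul_sampleLaw (S := S) (σ := σ) (V.effNoise S θ i)
        (sampleFunctional (V.extend i (euclMul (V.transfer S i) t)) 0)
      simp_rw [← V.inner_plus i] at this
      exact this.mono_exponent (by norm_num)
    · rw [hf, integral_const_mul, V.integral_effNoise_mul_inner hS, mul_zero]
    · simp_rw [hf, mul_pow (V.labelVar S σ θ i)⁻¹]
      rw [integral_const_mul, V.integral_effNoise_mul_inner_sq hS]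
      field_simp
  have hgoal : charFun ((multivariateGaussian 0 (V.precision S σ θ)).map id) t
      = ∏ i, Complex.exp (-((V.labelVar S σ θ i)⁻¹ * ((euclMul (V.transfer S i) t).ofLp ⬝ᵥ
        V.blockPP i S *ᵥ (euclMul (V.transfer S i) t).ofLp) : ℝ) / 2) := by
    rw [Measure.map_id, charFun_multivariateGaussian (V.precision_posSemidef hS hσ θ),
      ← Complex.exp_sum, V.dotProduct_precision_mulVec]
    congr 1
    simp only [inner_zero_right, Complex.ofReal_zero, zero_mul, zero_sub, Complex.ofReal_sum,
      neg_div, Finset.sum_neg_distrib, Finset.sum_div]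
  simp only [ProbabilityMeasure.coe_mk]
  rw [hgoal]
  simp_rw [hchar]
  exact hlim

/-- The Collab estimator is asymptotically normal. -/
lemma tendstoInDistribution_collab (h : IsGaussianData S σ x ξ P) (hS : S.PosDef) (hσ : 0 < σ)
    {θ : EuclideanSpace ℝ (Fin d)} (hC : IsUnit (V.precision S σ θ))
    {est : ℕ → Ω → EuclideanSpace ℝ (Fin d)} (hm : ∀ n, AEMeasurable (est n) P)
    (hest : ∀ n, ∀ᵐ ω ∂P, V.IsCollab S (fun i k => x n i k ω)
        (fun i k => inner ℝ (x n i k ω) θ + ξ n i k ω) (est n ω)) :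
    TendstoInDistribution (fun (n : ℕ) ω => √(n : ℝ) • (est n ω - θ)) atTop id (fun _ => P)
        (multivariateGaussian 0 (V.covG S σ θ)) := by
  have hU := h.tendstoInDistribution_totalScore V hS hσ θ
  have hCU := hU.continuous_comp (continuous_euclMul (V.covG S σ θ))
  -- The total score has limiting covariance `(C^g)⁻¹`, and `C^g` is symmetric, so applying `C^g`
  -- leaves `C^g (C^g)⁻¹ C^g = C^g`.
  have hlaw : (multivariateGaussian 0 (V.precision S σ θ)).map (euclMul (V.covG S σ θ) ∘ id)
      = (multivariateGaussian 0 (V.covG S σ θ)).map id := by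
    have hT : (V.covG S σ θ)ᵀ = V.covG S σ θ := by
      simpa [IsHermitian] using (V.covG_posSemidef hS hσ θ).isHermitian
    rw [Function.comp_id, multivariateGaussian_map_euclMul _ (V.precision_posSemidef hS hσ θ), hT,
      Matrix.mul_assoc, V.precision_mul_covG hC, Matrix.mul_one, Measure.map_id]
  have hCU' : TendstoInDistribution (fun n => euclMul (V.covG S σ θ) ∘ fun ω =>
      V.totalScore S σ θ fun i k => (x n i k ω, ξ n i k ω)) atTop id (fun _ => P)
      (multivariateGaussian 0 (V.covG S σ θ)) := by
    refine ⟨hCU.forall_aemeasurable, aemeasurable_id, ?_⟩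
    have := hCU.tendsto
    simp_rw [hlaw] at this
    exact this
  have hmY : ∀ n : ℕ, AEMeasurable (fun ω => √(n : ℝ) • (est n ω - θ)) P := fun n =>
    ((hm n).sub_const θ).const_smul √(n : ℝ)
  obtain ⟨K, hK⟩ := h.exists_integral_scoreSize_le V hS θ
  -- Slutsky's lemma: it remains to show that the normalized error minus its linear approximation
  -- tends to zero in probability.
  refine tendstoInDistribution_of_tendstoInMeasure_sub _ _ hCU' ?_ hmY
  refine tendstoInMeasure_zero_of_ae_tendsto_div
    (fun n => (hmY n).sub (hCU'.forall_aemeasurable n))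
    (fun n ω => V.scoreSize_nonneg (S := S) θ fun i k => (x n i k ω, ξ n i k ω))
    (fun n => (hK n).1) (fun n => (hK n).2) ?_
  filter_upwards [ae_all_iff.2 (h.ae_tendsto_meanGram V hS), ae_all_iff.2
    (h.ae_tendsto_meanScore V hS θ), ae_all_iff.2 (h.ae_tendsto_meanNoiseSq V hS θ),
    ae_all_iff.2 hest] with ω h1 h2 h3 h4
  exact V.tendsto_norm_collab_sub_div hS hσ hC
    (z := fun n i k => (x n i k ω, ξ n i k ω)) h1 h2 h3 h4

end IsGaussianData

lemma tendstoInDistribution_euclMul {Ω : Type*} [MeasurableSpace Ω] {P : Measure Ω}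
    [IsProbabilityMeasure P] {p q : ℕ} {Y : ℕ → Ω → EuclideanSpace ℝ (Fin q)}
    {K : Matrix (Fin q) (Fin q) ℝ} (hK : K.PosSemidef) (A : Matrix (Fin p) (Fin q) ℝ)
    (h : TendstoInDistribution Y atTop id (fun _ => P) (multivariateGaussian 0 K)) :
    TendstoInDistribution (fun n ω => euclMul A (Y n ω)) atTop id (fun _ => P)
      (multivariateGaussian 0 (A * K * Aᵀ)) := by
  have hA := h.continuous_comp (continuous_euclMul A)
  have hlaw : (multivariateGaussian 0 K).map (euclMul A ∘ id)
      = (multivariateGaussian 0 (A * K * Aᵀ)).map id := by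
    rw [Function.comp_id, multivariateGaussian_map_euclMul _ hK, Measure.map_id]
  refine ⟨hA.forall_aemeasurable, aemeasurable_id, ?_⟩
  have := hA.tendsto
  simp_rw [hlaw] at this
  exact this

theorem mainTheorem1 {m d : ℕ} (V : Views m d) (S : Matrix (Fin d) (Fin d) ℝ) (hS : S.PosDef)
    (σ : ℝ) (hσ : 0 < σ) (θ : EuclideanSpace ℝ (Fin d)) (hC : IsUnit (V.precision S σ θ))
    {Ω : Type*} [MeasurableSpace Ω] (P : Measure Ω) [IsProbabilityMeasure P]
    (X : (n : ℕ) → (i : Fin m) → Fin n → Ω → EuclideanSpace ℝ (Fin (V.obs i)))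
    (hX : V.IsGaussianDesign S X P) :
    -- full-feature lower bound
    (∀ u : EuclideanSpace ℝ (Fin d), ∀ᵐ ω ∂P,
      ENNReal.ofReal (u.ofLp ⬝ᵥ V.covG S σ θ *ᵥ u.ofLp) ≤
        liminf (fun c : ℝ => liminf (fun n : ℕ =>
          V.minimaxRisk S σ θ (fun i k => X n i k ω) id c u) atTop) atTop) ∧
    -- missing-feature lower bound
    (∀ (i : Fin m) (u : EuclideanSpace ℝ (Fin (V.obs i))), ∀ᵐ ω ∂P,
      ENNReal.ofReal
          (u.ofLp ⬝ᵥ (V.transfer S i * V.covG S σ θ * (V.transfer S i)ᵀ) *ᵥ u.ofLp) ≤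
        liminf (fun c : ℝ => liminf (fun n : ℕ =>
          V.minimaxRisk S σ θ (fun j k => X n j k ω) (euclMul (V.transfer S i)) c u)
            atTop) atTop) ∧
    -- the Collab estimators are asymptotically normal with exactly these covariances
    (∀ {Ω' : Type*} [MeasurableSpace Ω'] (P' : Measure Ω') [IsProbabilityMeasure P']
      (x : (n : ℕ) → Fin m → Fin n → Ω' → EuclideanSpace ℝ (Fin d))
      (ξ : (n : ℕ) → Fin m → Fin n → Ω' → ℝ) (_ : IsGaussianData S σ x ξ P')
      (est : ℕ → Ω' → EuclideanSpace ℝ (Fin d)) (_ : ∀ n, AEMeasurable (est n) P')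
      (_ : ∀ n, ∀ᵐ ω ∂P', V.IsCollab S (fun i k => x n i k ω)
        (fun i k => inner ℝ (x n i k ω) θ + ξ n i k ω) (est n ω)),
      TendstoInDistribution (fun (n : ℕ) ω => √(n : ℝ) • (est n ω - θ)) atTop id (fun _ => P')
        (multivariateGaussian 0 (V.covG S σ θ)) ∧
      ∀ i, TendstoInDistribution
        (fun (n : ℕ) ω => √(n : ℝ) • (euclMul (V.transfer S i) (est n ω) - euclMul (V.transfer S i) θ))
        atTop id (fun _ => P')
        (multivariateGaussian 0 (V.transfer S i * V.covG S σ θ * (V.transfer S i)ᵀ))) := by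
  -- Randomness of the design enters the lower bounds only through this event, so one null set
  -- serves all `u`.
  have hgram := Views.IsGaussianDesign.ae_tendsto_gram V hS hX
  refine ⟨fun u => ?_, fun i u => ?_, fun P' _ x ξ hdata est hm hest => ?_⟩
  · filter_upwards [hgram] with ω hω
    exact V.ofReal_le_liminf_minimaxRisk hS hσ θ hC (fun n i k => X n i k ω) hω fun _ => rfl
  · filter_upwards [hgram] with ω hω
    -- Estimating `⟨u, T_i ϑ⟩` is estimating `⟨T_iᵀ u, ϑ⟩`, so the bound for linear functionals of
    -- `ϑ` applies at `T_iᵀ u`.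
    have h := V.ofReal_le_liminf_minimaxRisk hS hσ θ hC (fun n i k => X n i k ω) hω
      (ψ := euclMul (V.transfer S i)) (u := u) (u' := euclMul (V.transfer S i)ᵀ u) fun ϑ => by
        rw [inner_euclMul, transpose_transpose]
    rw [← mulVec_mulVec, ← mulVec_mulVec, dotProduct_mulVec, ← mulVec_transpose]
    exact h
  · have h := hdata.tendstoInDistribution_collab V hS hσ hC hm hest
    refine ⟨h, fun i => ?_⟩
    simpa only [euclMul_smul, euclMul_sub] using
      tendstoInDistribution_euclMul (V.covG_posSemidef hS hσ θ) (V.transfer S i) h
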